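/- Let $\alpha\in(1,\infty)$, let $\mathcal H_A\cong\mathcal H_{A'}$ and $\mathcal H_B$ be nonzero finite-dimensional complex Hilbert spaces with $\mathcal H_A,\mathcal H_{A'}$ carrying fixed orthonormal bases $\{|i\rangle\}$, and let $\mathcal N:\mathcal B(\mathcal H_{A'})\to\mathcal B(\mathcal H_B)$ be a quantum channel (a completely positive trace-preserving linear map). Write $\mathcal S(\mathcal H)$ for the density operators on $\mathcal H$ (positive semidefinite, trace one). For density operators $\rho,\sigma$ let $$\widetilde D_\alpha(\rho\Vert\sigma)=\frac1{\alpha-1}\log_2\operatorname{Tr}\Bigl\{\bigl(\sigma^{\frac{1-\alpha}{2\alpha}}\rho\,\sigma^{\frac{1-\alpha}{2\alpha}}\bigr)^{\alpha}\Bigr\}$$ if the support of $\rho$ is contained in the support of $\sigma$ (negative powers being taken on the support), and $\widetilde D_\alpha(\rho\Vert\sigma)=+\infty$ otherwise. Let $|\Gamma\rangle_{AA'}=\sum_i|i\rangle_A|i\rangle_{A'}$, let $\Gamma^{\mathcal N}_{AB}=(\mathrm{id}_A\otimes\mathcal N_{A'\to B})(|\Gamma\rangle\langle\Gamma|_{AA'})$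 be the Choi matrix of $\mathcal N$, and for $\rho_A\in\mathcal S(\mathcal H_A)$ let $\omega_{AB}=(\rho_A^{1/2}\otimes I_B)\,\Gamma^{\mathcal N}_{AB}\,(\rho_A^{1/2}\otimes I_B)$, abbreviated $\rho_A^{1/2}\Gamma^{\mathcal N}_{AB}\rho_A^{1/2}$, with reduced operator $\omega_A=\operatorname{Tr}_B\omega_{AB}$. The sandwiched Rényi mutual information of $\mathcal N$ is $$\widetilde I_\alpha(\mathcal N)=\max_{\rho_A\in\mathcal S(\mathcal H_A)}\ \min_{\sigma_B\in\mathcal S(\mathcal H_B)}\widetilde D_\alpha\bigl(\omega_{AB}\Vert\omega_A\otimes\sigma_B\bigr).$$ Then $$\widetilde I_\alpha(\mathcal N)=\max_{\rho_A}\min_{\sigma_B}\widetilde D_\alpha\bigl(\rho_A^{1/2}\Gamma^{\mathcal N}_{AB}\rho_A^{1/2}\Vert\rho_A\otimes\sigma_B\bigr)=\min_{\sigma_B}\max_{\rho_A}\widetilde D_\alpha\bigl(\rho_A^{1/2}\Gamma^{\mathcal N}_{AB}\rho_A^{1/2}\Vert\rho_A\otimes\sigma_B\bigr),$$ where $\rho_A$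 ranges over $\mathcal S(\mathcal H_A)$ and $\sigma_B$ over $\mathcal S(\mathcal H_B)$, and all maxima and minima (in $\mathbb R\cup\{+\infty\}$), including those in the definition of $\widetilde I_\alpha(\mathcal N)$, are attained. -/

import Mathlib

open scoped MatrixOrder ComplexOrder Kronecker

noncomputable section

namespace QuantumChannel

variable {A B R n : Type*} [Fintype A] [DecidableEq A] [Fintype B] [DecidableEq B]
  [Fintype R] [DecidableEq R] [Fintype n] [DecidableEq n]

/-- The set `𝒮(ℂⁿ)` of density operators: positive semidefinite matrices of trace one. -/
def densityOperators (n : Type*) [Fintype n] : Set (Matrix n n ℂ) :=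
  {ρ | ρ.PosSemidef ∧ ρ.trace = 1}

/-- The map `id_R ⊗ N`, applied to a matrix on the composite system `R ⊗ A`: the map `N` acts on
each of the blocks of the matrix. -/
def idTensor (R : Type*) (N : Matrix A A ℂ →ₗ[ℂ] Matrix B B ℂ)
    (M : Matrix (R × A) (R × A) ℂ) : Matrix (R × B) (R × B) ℂ :=
  Matrix.of fun x y => N (Matrix.of fun a a' => M (x.1, a) (y.1, a')) x.2 y.2

/-- `N` is completely positive: `id_R ⊗ N` is positive for a reference system `R` of any
(finite) dimension. -/
def IsCompletelyPositive (N : Matrix A A ℂ →ₗ[ℂ] Matrix B B ℂ) : Prop :=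
  ∀ (k : ℕ) (M : Matrix (Fin k × A) (Fin k × A) ℂ),
    M.PosSemidef → (idTensor (Fin k) N M).PosSemidef

/-- `N` is trace preserving. -/
def IsTracePreserving (N : Matrix A A ℂ →ₗ[ℂ] Matrix B B ℂ) : Prop :=
  ∀ X : Matrix A A ℂ, (N X).trace = X.trace

/-- A quantum channel is a completely positive and trace-preserving linear map. -/
def IsQuantumChannel (N : Matrix A A ℂ →ₗ[ℂ] Matrix B B ℂ) : Prop :=
  IsCompletelyPositive N ∧ IsTracePreserving N

/-- The unnormalised maximally entangled vector `|Γ⟩ = ∑ i, |i⟩|i⟩`. -/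
def maxEntangledVec (A : Type*) [Fintype A] [DecidableEq A] : A × A → ℂ :=
  ∑ i : A, Pi.single (i, i) 1

/-- The rank-one operator `|Γ⟩⟨Γ|`. -/
def maxEntangledOp (A : Type*) [Fintype A] [DecidableEq A] : Matrix (A × A) (A × A) ℂ :=
  Matrix.vecMulVec (maxEntangledVec A) (star (maxEntangledVec A))

/-- The Choi matrix `Γ^N_{AB} = (id_A ⊗ N_{A' → B})(|Γ⟩⟨Γ|_{AA'})`. -/
def choi (N : Matrix A A ℂ →ₗ[ℂ] Matrix B B ℂ) : Matrix (A × B) (A × B) ℂ :=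
  idTensor A N (maxEntangledOp A)

/-- The operator `ω_{AB} = ρ_A^{1/2} Γ^N_{AB} ρ_A^{1/2}`, where `ρ_A^{1/2}` acts as
`ρ_A^{1/2} ⊗ I_B`. -/
def channelState (N : Matrix A A ℂ →ₗ[ℂ] Matrix B B ℂ) (ρ : Matrix A A ℂ) :
    Matrix (A × B) (A × B) ℂ :=
  (CFC.rpow ρ (1 / 2) ⊗ₖ (1 : Matrix B B ℂ)) * choi N *
    (CFC.rpow ρ (1 / 2) ⊗ₖ (1 : Matrix B B ℂ))

/-- The partial trace over the second system, `τ_A = Tr_B τ_{AB}`. -/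
def traceB (τ : Matrix (A × B) (A × B) ℂ) : Matrix A A ℂ :=
  Matrix.of fun a a' => ∑ b, τ (a, b) (a', b)

/-- The support of `ρ` is contained in the support of `σ`. The support of a Hermitian matrix is the
orthogonal complement of its kernel, so this is the reverse inclusion of kernels. -/
def SupportLE (ρ σ : Matrix n n ℂ) : Prop :=
  ∀ v : n → ℂ, σ.mulVec v = 0 → ρ.mulVec v = 0

open scoped Classical in
/-- The sandwiched Rényi relative entropy
`(α - 1)⁻¹ log₂ Tr ((σ^((1-α)/(2α)) ρ σ^((1-α)/(2α)))^α)` if the support of `ρ` is contained in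
that of `σ`, and `+∞` otherwise. Negative powers are powers on the support
(`CFC.rpow` applies `x ↦ x ^ s` to the eigenvalues, with `0 ^ s = 0` for `s ≠ 0`). -/
def sandwichedRenyi (α : ℝ) (ρ σ : Matrix n n ℂ) : EReal :=
  if SupportLE ρ σ then
    ((1 / (α - 1) * Real.logb 2
      (CFC.rpow (CFC.rpow σ ((1 - α) / (2 * α)) * ρ * CFC.rpow σ ((1 - α) / (2 * α))) α).trace.re
        : ℝ) : EReal)
  else ⊤

/-- The sandwiched Rényi mutual information of a bipartite state,
`min_{σ_B} D_α(τ_{AB} ‖ τ_A ⊗ σ_B)`. -/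
def stateMutualInfo (α : ℝ) (τ : Matrix (A × B) (A × B) ℂ) : EReal :=
  ⨅ σ : densityOperators B, sandwichedRenyi α τ (traceB τ ⊗ₖ σ.1)

/-- The sandwiched Rényi mutual information of a channel, `max_{ρ_A} I_α(A;B)_ω`. -/
def channelMutualInfo (α : ℝ) (N : Matrix A A ℂ →ₗ[ℂ] Matrix B B ℂ) : EReal :=
  ⨆ ρ : densityOperators A, stateMutualInfo α (channelState N ρ.1)

end QuantumChannel

end

open QuantumChannel

/-!
Write `p = 1/α`, `Γ` for the Choi matrix, and `ω = ρ^(1/2) Γ ρ^(1/2)`. Since the channel is trace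
preserving, `Tr_B Γ = 1`, so that `ω_A = ρ`; this identifies the divergence in the definition of
the mutual information with the divergence relative to `ρ ⊗ σ`. As `Mᴴ M` and `M Mᴴ` have the same
eigenvalues, the latter is, when the supports are nested, an increasing function of the Schatten
`α`-norm of `Γ^(1/2) (ρ^p ⊗ σ^(p-1)) Γ^(1/2)` (`choiDivergence_eq`).

By Hölder duality this norm is the maximum over states `τ` of
`Φ(ρ, τ; σ) = Tr Γ^(1/2) (ρ^p ⊗ σ^(p-1)) Γ^(1/2) τ^(1-p)`. The functional `Φ` is jointly concave
in `(ρ, τ)` by Lieb's concavity theorem (`concaveOn_re_trace_rpow_mul_rpow`), which for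
exponents `p` and `1 - p` follows from the integral representation of `x ↦ x^p` and the
variational formula for the parallel sum. It is convex in `σ`, as `σ ↦ σ^(p-1)` is operator convex
(`convexOn_rpow_sub_one`). On invertible `σ` it is continuous, and the pairs `(ρ, τ)` form a
compact convex set, so Sion's theorem exchanges the maximum and the infimum over invertible `σ`
(`exists_forall_le_schattenNorm`).

Singular `σ`, where the divergence may be infinite, are reached through the mixtures
`σ_t = (1 - t) σ + t 1/d`. All the matrices involved commute, so it is elementary that the
divergence at `σ_t` exceeds that at `σ` by at most `- log₂ (1 - t)`
(`choiDivergence_mixture_le`), and that bounds on it along `t → 0` pass to `σ`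
(`choiDivergence_le_of_forall_mixture_le`). Hence the divergence is lower semicontinuous in `σ`,
and its infimum over all `σ` is an infimum over invertible `σ`, which is upper semicontinuous in
`ρ`; with the compactness of the sets of density operators all extrema
are attained (`minimax_of_approximation`). The maximum over `ρ` at a fixed singular `σ` is attained
because the divergence there either takes the value `+∞` or is finite, hence continuous, in `ρ`.
-/

namespace QuantumChannel

open Matrix

/-! ### Real powers of positive semidefinite matrices -/

section FunctionalCalculus

variable {n m : Type*} [Fintype n] [DecidableEq n] [Fintype m] [DecidableEq m]

/-- The functional calculus may be computed in any diagonalization, not only in the one chosen by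
`Matrix.IsHermitian.eigenvectorUnitary`. -/
theorem cfc_conj_diagonal (f : ℝ → ℝ) {U : Matrix n n ℂ} (hU : U ∈ unitaryGroup n ℂ) (d : n → ℝ) :
    cfc f (U * diagonal (fun i => (d i : ℂ)) * Uᴴ) =
      U * diagonal (fun i => (f (d i) : ℂ)) * Uᴴ := by
  set M := U * diagonal (fun i => (d i : ℂ)) * Uᴴ with hM
  have hsa : IsSelfAdjoint M := by
    rw [IsSelfAdjoint, star_eq_conjTranspose, hM]
    simp only [conjTranspose_mul, conjTranspose_conjTranspose, diagonal_conjTranspose, mul_assoc]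
    congr 3
    ext i; simp
  have hfin : (spectrum ℝ M ∪ Set.range d).Finite :=
    (Matrix.finite_real_spectrum).union (Set.finite_range d)
  -- on the finite set of eigenvalues, `f` agrees with a polynomial
  let q := Lagrange.interpolate hfin.toFinset id f
  have hq : ∀ x ∈ spectrum ℝ M ∪ Set.range d, q.eval x = f x := fun x hx =>
    Lagrange.eval_interpolate_at_node f (v := id) Function.injective_id.injOn
      (hfin.mem_toFinset.2 hx)
  let φ : Matrix n n ℂ →ₐ[ℝ] Matrix n n ℂ :=
    AlgHom.restrictScalars ℝ
      (((Unitary.conjStarAlgAut ℂ (Matrix n n ℂ) ⟨U, hU⟩).toAlgEquiv : _ ≃ₐ[ℂ] _).toAlgHom)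
  have hφ : ∀ X, φ X = U * X * Uᴴ := fun X => rfl
  let ψ : (n → ℝ) →ₐ[ℝ] Matrix n n ℂ :=
    ((diagonalAlgHom ℝ (α := ℂ) (n := n)).comp (AlgHom.compLeft Complex.ofRealAm n))
  have hψ : ∀ x : n → ℝ, ψ x = diagonal (fun i => (x i : ℂ)) := fun x => rfl
  have h1 : cfc f M = Polynomial.aeval M q := by
    rw [← cfc_polynomial q M hsa]
    exact cfc_congr fun x hx => (hq x (Or.inl hx)).symm
  have h2 : M = φ (ψ d) := by rw [hφ, hψ]
  rw [h1, h2, Polynomial.aeval_algHom_apply, Polynomial.aeval_algHom_apply, hφ, hψ]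
  congr 3
  ext i
  rw [Polynomial.aeval_pi_apply]
  simp only [Polynomial.coe_aeval_eq_eval, Complex.ofReal_inj]
  exact hq _ (Or.inr ⟨i, rfl⟩)

theorem posSemidef_conj_diagonal (U : Matrix n n ℂ) {d : n → ℝ} (hd : ∀ i, 0 ≤ d i) :
    (U * diagonal (fun i => (d i : ℂ)) * Uᴴ).PosSemidef :=
  (PosSemidef.diagonal fun i => by simpa using hd i).mul_mul_conjTranspose_same U

theorem rpow_conj_diagonal (s : ℝ) {U : Matrix n n ℂ} (hU : U ∈ unitaryGroup n ℂ) {d : n → ℝ}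
    (hd : ∀ i, 0 ≤ d i) :
    CFC.rpow (U * diagonal (fun i => (d i : ℂ)) * Uᴴ) s =
      U * diagonal (fun i => ((d i ^ s : ℝ) : ℂ)) * Uᴴ := by
  rw [CFC.rpow, cfc_nnreal_eq_real _ _ (posSemidef_conj_diagonal U hd).nonneg,
    cfc_conj_diagonal _ hU]
  congr 3
  ext i
  simp [Real.coe_toNNReal _ (hd i)]

theorem exists_eq_conj_diagonal {M : Matrix n n ℂ} (hM : M.PosSemidef) :
    ∃ U ∈ unitaryGroup n ℂ, ∃ d : n → ℝ, (∀ i, 0 ≤ d i) ∧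
      M = U * diagonal (fun i => (d i : ℂ)) * Uᴴ :=
  ⟨hM.1.eigenvectorUnitary, Subtype.prop _, hM.1.eigenvalues, hM.eigenvalues_nonneg, by
    conv_lhs => rw [hM.1.spectral_theorem]
    rfl⟩

theorem posSemidef_rpow (M : Matrix n n ℂ) (s : ℝ) : (CFC.rpow M s).PosSemidef :=
  (CFC.rpow_nonneg (a := M) (y := s)).posSemidef

theorem conjTranspose_rpow (M : Matrix n n ℂ) (s : ℝ) : (CFC.rpow M s)ᴴ = CFC.rpow M s :=
  (posSemidef_rpow M s).1

theorem conj_mul_conj {U : Matrix n n ℂ} (hU : U ∈ unitaryGroup n ℂ) (X Y : Matrix n n ℂ) :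
    (U * X * Uᴴ) * (U * Y * Uᴴ) = U * (X * Y) * Uᴴ := by
  have : Uᴴ * U = 1 := mem_unitaryGroup_iff'.1 hU
  calc _ = U * X * (Uᴴ * U) * Y * Uᴴ := by simp only [mul_assoc]
    _ = _ := by rw [this]; simp only [mul_assoc, one_mul]

/-- The law of exponents on singular matrices: `0 ^ s * 0 ^ t = 0 ^ (s + t)` holds unless
`s + t = 0`. -/
theorem rpow_mul_rpow {M : Matrix n n ℂ} (hM : M.PosSemidef) {s t : ℝ} (hst : s + t ≠ 0) :
    CFC.rpow M s * CFC.rpow M t = CFC.rpow M (s + t) := by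
  obtain ⟨U, hU, d, hd, rfl⟩ := exists_eq_conj_diagonal hM
  simp only [rpow_conj_diagonal _ hU hd, conj_mul_conj hU, diagonal_mul_diagonal]
  congr 3
  ext i
  rw [Real.rpow_add' (hd i) hst, Complex.ofReal_mul]

theorem rpow_one_eq {M : Matrix n n ℂ} (hM : M.PosSemidef) : CFC.rpow M 1 = M :=
  CFC.rpow_one M hM.nonneg

theorem one_rpow_eq (s : ℝ) : CFC.rpow (1 : Matrix n n ℂ) s = 1 :=
  CFC.one_rpow

theorem kronecker_mem_unitaryGroup {U : Matrix n n ℂ} {V : Matrix m m ℂ}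
    (hU : U ∈ unitaryGroup n ℂ) (hV : V ∈ unitaryGroup m ℂ) :
    U ⊗ₖ V ∈ unitaryGroup (n × m) ℂ :=
  kronecker_mem_unitary hU hV

theorem rpow_kronecker {M : Matrix n n ℂ} {N : Matrix m m ℂ} (hM : M.PosSemidef)
    (hN : N.PosSemidef) (s : ℝ) :
    CFC.rpow (M ⊗ₖ N) s = CFC.rpow M s ⊗ₖ CFC.rpow N s := by
  obtain ⟨U, hU, d, hd, rfl⟩ := exists_eq_conj_diagonal hM
  obtain ⟨V, hV, e, he, rfl⟩ := exists_eq_conj_diagonal hN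
  have key : ∀ (d : n → ℝ) (e : m → ℝ),
      (U * diagonal (fun i => (d i : ℂ)) * Uᴴ) ⊗ₖ (V * diagonal (fun i => (e i : ℂ)) * Vᴴ) =
      (U ⊗ₖ V) * diagonal (fun i : n × m => ((d i.1 * e i.2 : ℝ) : ℂ)) * (U ⊗ₖ V)ᴴ := by
    intro d e
    rw [mul_kronecker_mul, mul_kronecker_mul, diagonal_kronecker_diagonal, conjTranspose_kronecker]
    simp
  rw [rpow_conj_diagonal s hU hd, rpow_conj_diagonal s hV he, key, key,
    rpow_conj_diagonal s (kronecker_mem_unitaryGroup hU hV)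
      fun i => mul_nonneg (hd i.1) (he i.2)]
  congr 3
  ext i
  rw [Real.mul_rpow (hd i.1) (he i.2)]

/-- `Tr (Mᴴ M)^s = Tr (M Mᴴ)^s`, since `Mᴴ M` and `M Mᴴ` have the same characteristic polynomial,
hence the same eigenvalues. -/
theorem trace_rpow_conjTranspose_mul_comm (M : Matrix n n ℂ) (s : ℝ) :
    (CFC.rpow (Mᴴ * M) s).trace = (CFC.rpow (M * Mᴴ) s).trace := by
  have key : ∀ {X : Matrix n n ℂ} (hX : X.PosSemidef), (CFC.rpow X s).trace =
      (X.charpoly.roots.map fun z => ((z.re ^ s : ℝ) : ℂ)).sum := by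
    intro X hX
    have h0 := hX.1.spectral_theorem
    have h1 : X = (hX.1.eigenvectorUnitary : Matrix n n ℂ) *
      diagonal (fun i => (hX.1.eigenvalues i : ℂ)) * (hX.1.eigenvectorUnitary : Matrix n n ℂ)ᴴ := h0
    rw [hX.1.roots_charpoly_eq_eigenvalues]
    conv_lhs => rw [h1, rpow_conj_diagonal s (Subtype.prop _) hX.eigenvalues_nonneg]
    rw [trace_mul_comm, ← mul_assoc]
    have : (hX.1.eigenvectorUnitary : Matrix n n ℂ)ᴴ *
        (hX.1.eigenvectorUnitary : Matrix n n ℂ) = 1 :=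
      mem_unitaryGroup_iff'.1 (Subtype.prop _)
    rw [this, one_mul, trace_diagonal]
    simp
  rw [key (posSemidef_conjTranspose_mul_self M), key (posSemidef_self_mul_conjTranspose M),
    charpoly_mul_comm]

/-- For diagonalized `X` and `Y`, `Tr X K Y Kᴴ` is a sum over pairs of eigenvalues with nonnegative
weights. -/
theorem re_trace_conj_diagonal_mul (U V : Matrix n n ℂ) (a b : n → ℝ) (K : Matrix n n ℂ) :
    ((U * diagonal (fun i => (a i : ℂ)) * Uᴴ) * K *
      (V * diagonal (fun i => (b i : ℂ)) * Vᴴ) * Kᴴ).trace.re =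
      ∑ i, ∑ j, a i * b j * Complex.normSq ((Uᴴ * K * V) i j) := by
  have h : ((U * diagonal (fun i => (a i : ℂ)) * Uᴴ) * K *
      (V * diagonal (fun i => (b i : ℂ)) * Vᴴ) * Kᴴ).trace =
      (diagonal (fun i => (a i : ℂ)) * (Uᴴ * K * V) * diagonal (fun i => (b i : ℂ)) *
        (Uᴴ * K * V)ᴴ).trace := by
    simp only [conjTranspose_mul, conjTranspose_conjTranspose]
    rw [mul_assoc U, mul_assoc U, mul_assoc U, mul_assoc U, trace_mul_comm U]
    simp only [mul_assoc]
  rw [h, trace, Complex.re_sum]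
  refine Finset.sum_congr rfl fun i _ => ?_
  rw [diag_apply, mul_apply, Complex.re_sum]
  refine Finset.sum_congr rfl fun j _ => ?_
  rw [mul_diagonal, diagonal_mul, conjTranspose_apply]
  have : ∀ z : ℂ, ((a i : ℂ) * z * (b j : ℂ) * star z) =
      ((a i * b j * Complex.normSq z : ℝ) : ℂ) := fun z => by
    push_cast
    rw [← Complex.mul_conj z]
    simp only [Complex.star_def]
    ring
  rw [this, Complex.ofReal_re]

theorem re_trace_mul_nonneg {X Y : Matrix n n ℂ} (hX : X.PosSemidef) (hY : Y.PosSemidef) :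
    0 ≤ (X * Y).trace.re := by
  obtain ⟨U, hU, a, ha, rfl⟩ := exists_eq_conj_diagonal hX
  obtain ⟨V, hV, b, hb, rfl⟩ := exists_eq_conj_diagonal hY
  have := re_trace_conj_diagonal_mul U V a b 1
  simp only [mul_one, conjTranspose_one] at this
  rw [this]
  exact Finset.sum_nonneg fun i _ => Finset.sum_nonneg fun j _ =>
    mul_nonneg (mul_nonneg (ha i) (hb j)) (Complex.normSq_nonneg _)

theorem re_trace_mul_le_re_trace_mul {X X' Y : Matrix n n ℂ} (h : X ≤ X') (hY : Y.PosSemidef) :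
    (X * Y).trace.re ≤ (X' * Y).trace.re := by
  have := re_trace_mul_nonneg (le_iff.1 h) hY
  rw [sub_mul, trace_sub, Complex.sub_re] at this
  linarith

theorem sum_normSq_row {W : Matrix n n ℂ} (hW : W ∈ unitaryGroup n ℂ) (i : n) :
    ∑ j, Complex.normSq (W i j) = 1 := by
  have h := congrFun (congrFun (mem_unitaryGroup_iff.1 hW) i) i
  rw [mul_apply, one_apply_eq] at h
  have h2 := congrArg Complex.re h
  rw [Complex.re_sum] at h2
  rw [← Complex.one_re, ← h2]
  refine Finset.sum_congr rfl fun j _ => ?_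
  rw [star_apply, Complex.star_def, Complex.mul_conj, Complex.ofReal_re]

theorem sum_normSq_col {W : Matrix n n ℂ} (hW : W ∈ unitaryGroup n ℂ) (j : n) :
    ∑ i, Complex.normSq (W i j) = 1 := by
  have h := sum_normSq_row (Unitary.star_mem hW) j
  simpa [star_apply] using h

theorem re_trace_conj_diagonal {U : Matrix n n ℂ} (hU : U ∈ unitaryGroup n ℂ) (d : n → ℝ) :
    (U * diagonal (fun i => (d i : ℂ)) * Uᴴ).trace.re = ∑ i, d i := by
  rw [trace_mul_comm, ← mul_assoc, show Uᴴ * U = 1 from mem_unitaryGroup_iff'.1 hU, one_mul,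
    trace_diagonal, Complex.re_sum]
  simp

end FunctionalCalculus

/-! ### Schatten norms and Hölder duality -/

section Schatten

variable {n : Type*} [Fintype n] [DecidableEq n]

/-- The Schatten `α`-norm `(Tr X^α)^(1/α)` of a positive semidefinite matrix `X`. -/
noncomputable def schattenNorm (α : ℝ) (X : Matrix n n ℂ) : ℝ :=
  ((CFC.rpow X α).trace.re) ^ (1 / α)

theorem re_trace_rpow_nonneg (α : ℝ) (X : Matrix n n ℂ) : 0 ≤ (CFC.rpow X α).trace.re :=
  (Complex.nonneg_iff.1 (posSemidef_rpow X α).trace_nonneg).1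

theorem schattenNorm_nonneg (α : ℝ) (X : Matrix n n ℂ) : 0 ≤ schattenNorm α X :=
  Real.rpow_nonneg (re_trace_rpow_nonneg α X) _

theorem re_trace_rpow_eq_schattenNorm_rpow {α : ℝ} (hα : 1 < α) (X : Matrix n n ℂ) :
    (CFC.rpow X α).trace.re = schattenNorm α X ^ α := by
  rw [schattenNorm, ← Real.rpow_mul (re_trace_rpow_nonneg α X), one_div_mul_cancel (by linarith),
    Real.rpow_one]

theorem eq_zero_of_re_trace_rpow_eq_zero {α : ℝ} (hα : 1 < α) {X : Matrix n n ℂ}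
    (hX : X.PosSemidef) (h : (CFC.rpow X α).trace.re = 0) : X = 0 := by
  obtain ⟨U, hU, x, hx, rfl⟩ := exists_eq_conj_diagonal hX
  rw [rpow_conj_diagonal α hU hx, re_trace_conj_diagonal hU] at h
  have h0 := (Finset.sum_eq_zero_iff_of_nonneg fun i _ => Real.rpow_nonneg (hx i) α).1 h
  have : x = 0 := funext fun i =>
    (Real.rpow_eq_zero (hx i) (by linarith)).1 (h0 i (Finset.mem_univ i))
  simp [this]

/-- Hölder's inequality for the Schatten norms, against a state `τ`. -/
theorem re_trace_mul_rpow_le_schattenNorm {α : ℝ} (hα : 1 < α) {X τ : Matrix n n ℂ}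
    (hX : X.PosSemidef) (hτ : τ ∈ densityOperators n) :
    (X * CFC.rpow τ (1 - 1 / α)).trace.re ≤ schattenNorm α X := by
  rcases (re_trace_rpow_nonneg α X).eq_or_lt with h0 | hS
  · rw [eq_zero_of_re_trace_rpow_eq_zero hα hX h0.symm]
    simpa using schattenNorm_nonneg α (0 : Matrix n n ℂ)
  obtain ⟨hτ0, hτ1⟩ := hτ
  set c := schattenNorm α X with hc
  have hα0 : 0 < α := by linarith
  have hc0 : 0 < c := Real.rpow_pos_of_pos hS _
  have hcα : c ^ α = (CFC.rpow X α).trace.re := (re_trace_rpow_eq_schattenNorm_rpow hα X).symm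
  obtain ⟨U, hU, x, hx, rfl⟩ := exists_eq_conj_diagonal hX
  obtain ⟨V, hV, t, ht, rfl⟩ := exists_eq_conj_diagonal hτ0
  have htr : ∑ j, t j = 1 := by rw [← re_trace_conj_diagonal hV, hτ1, Complex.one_re]
  rw [rpow_conj_diagonal α hU hx, re_trace_conj_diagonal hU] at hcα
  rw [rpow_conj_diagonal _ hV ht]
  have hre := re_trace_conj_diagonal_mul U V x (fun j => t j ^ (1 - 1 / α)) 1
  simp only [mul_one, conjTranspose_one] at hre
  rw [hre]
  set W := Uᴴ * V with hW
  have hWu : W ∈ unitaryGroup n ℂ := mul_mem (Unitary.star_mem hU) hV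
  have hp1 : 1 / α ≤ 1 := by rw [div_le_one hα0]; exact hα.le
  -- Young's inequality, scaled so that equality is possible after summation
  have hY : ∀ i j, x i * t j ^ (1 - 1 / α) ≤
      c * ((1 / α) * (x i ^ α / c ^ α) + (1 - 1 / α) * t j) := by
    intro i j
    have := Real.geom_mean_le_arith_mean2_weighted (w₁ := 1 / α) (w₂ := 1 - 1 / α)
      (p₁ := x i ^ α / c ^ α) (p₂ := t j) (by positivity) (by linarith)
      (div_nonneg (Real.rpow_nonneg (hx i) _) (Real.rpow_nonneg hc0.le _)) (ht j) (by ring)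
    rw [← Real.div_rpow (hx i) hc0.le, ← Real.rpow_mul (div_nonneg (hx i) hc0.le),
      mul_one_div_cancel hα0.ne', Real.rpow_one, Real.div_rpow (hx i) hc0.le] at this
    calc x i * t j ^ (1 - 1 / α) = c * (x i / c * t j ^ (1 - 1 / α)) := by
          field_simp
      _ ≤ _ := mul_le_mul_of_nonneg_left this hc0.le
  calc ∑ i, ∑ j, x i * t j ^ (1 - 1 / α) * Complex.normSq (W i j)
      ≤ ∑ i, ∑ j, c * ((1 / α) * (x i ^ α / c ^ α) + (1 - 1 / α) * t j) *
          Complex.normSq (W i j) :=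
        Finset.sum_le_sum fun i _ => Finset.sum_le_sum fun j _ =>
          mul_le_mul_of_nonneg_right (hY i j) (Complex.normSq_nonneg _)
    _ = c * ((1 / α) * (∑ i, (x i ^ α / c ^ α) * ∑ j, Complex.normSq (W i j)) +
          (1 - 1 / α) * ∑ j, t j * ∑ i, Complex.normSq (W i j)) := by
        simp only [Finset.mul_sum, mul_add]
        rw [Finset.sum_comm (s := (Finset.univ : Finset n)) (t := Finset.univ)
          (f := fun j i => c * ((1 - 1 / α) * (t j * Complex.normSq (W i j)))),
          ← Finset.sum_add_distrib]
        refine Finset.sum_congr rfl fun i _ => ?_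
        rw [← Finset.sum_add_distrib]
        refine Finset.sum_congr rfl fun j _ => ?_
        ring
    _ = c := by
        simp only [sum_normSq_row hWu, sum_normSq_col hWu, mul_one, htr]
        rw [← Finset.sum_div, hcα, div_self (by rw [← hcα]; positivity)]
        ring

/-- Hölder's inequality is attained, at the state proportional to `X^α`. -/
theorem exists_schattenNorm_eq_re_trace_mul_rpow [Nonempty n] {α : ℝ} (hα : 1 < α)
    {X : Matrix n n ℂ} (hX : X.PosSemidef) :
    ∃ τ ∈ densityOperators n, schattenNorm α X = (X * CFC.rpow τ (1 - 1 / α)).trace.re := by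
  have hα0 : 0 < α := by linarith
  rcases (re_trace_rpow_nonneg α X).eq_or_lt with h0 | hS
  · have hX0 := eq_zero_of_re_trace_rpow_eq_zero hα hX h0.symm
    obtain ⟨i⟩ := ‹Nonempty n›
    refine ⟨diagonal (Pi.single i 1), ⟨PosSemidef.diagonal fun j => ?_, ?_⟩, ?_⟩
    · by_cases h : j = i
      · subst h; simp
      · simp [h]
    · simp [trace_diagonal]
    · rw [schattenNorm, ← h0, hX0, Real.zero_rpow (by positivity)]
      simp
  · set S := (CFC.rpow X α).trace.re with hSdef
    obtain ⟨U, hU, x, hx, rfl⟩ := exists_eq_conj_diagonal hX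
    have hSx : S = ∑ i, x i ^ α := by
      rw [hSdef, rpow_conj_diagonal α hU hx, re_trace_conj_diagonal hU]
    have hd : ∀ i, 0 ≤ x i ^ α / S := fun i => div_nonneg (Real.rpow_nonneg (hx i) _) hS.le
    refine ⟨U * diagonal (fun i => ((x i ^ α / S : ℝ) : ℂ)) * Uᴴ,
      ⟨posSemidef_conj_diagonal U hd, ?_⟩, ?_⟩
    · rw [trace_mul_comm, ← mul_assoc, show Uᴴ * U = 1 from mem_unitaryGroup_iff'.1 hU, one_mul,
        trace_diagonal, ← Complex.ofReal_sum, ← Finset.sum_div, ← hSx, div_self hS.ne',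
        Complex.ofReal_one]
    · rw [rpow_conj_diagonal _ hU hd, conj_mul_conj hU, diagonal_mul_diagonal]
      simp only [← Complex.ofReal_mul]
      rw [re_trace_conj_diagonal hU, schattenNorm, ← hSdef]
      have : ∀ i, x i * (x i ^ α / S) ^ (1 - 1 / α) = x i ^ α * (S ^ (1 - 1 / α))⁻¹ := by
        intro i
        rw [Real.div_rpow (Real.rpow_nonneg (hx i) _) hS.le, ← Real.rpow_mul (hx i),
          div_eq_mul_inv, ← mul_assoc]
        congr 1
        rw [show α * (1 - 1 / α) = α - 1 by field_simp]
        nth_rewrite 1 [← Real.rpow_one (x i)]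
        rw [← Real.rpow_add' (hx i) (by simpa using hα0.ne')]
        congr 1; ring
      simp only [this]
      rw [← Finset.sum_mul, ← hSx, ← Real.rpow_neg hS.le]
      nth_rewrite 2 [← Real.rpow_one S]
      rw [← Real.rpow_add hS]
      congr 1; ring

theorem schattenNorm_mono [Nonempty n] {α : ℝ} (hα : 1 < α) {X Y : Matrix n n ℂ}
    (hX : X.PosSemidef) (hXY : X ≤ Y) : schattenNorm α X ≤ schattenNorm α Y := by
  have hY : Y.PosSemidef := (hX.nonneg.trans hXY).posSemidef
  obtain ⟨τ, hτ, h⟩ := exists_schattenNorm_eq_re_trace_mul_rpow hα hX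
  rw [h]
  exact (re_trace_mul_le_re_trace_mul hXY (posSemidef_rpow τ _)).trans
    (re_trace_mul_rpow_le_schattenNorm hα hY hτ)

theorem schattenNorm_smul [Nonempty n] {α : ℝ} (hα : 1 < α) {X : Matrix n n ℂ}
    (hX : X.PosSemidef) {c : ℝ} (hc : 0 ≤ c) :
    schattenNorm α (c • X) = c * schattenNorm α X := by
  have hcX : (c • X).PosSemidef := hX.smul hc
  have hlin : ∀ Y : Matrix n n ℂ, ((c • X) * Y).trace.re = c * (X * Y).trace.re := fun Y => by
    rw [smul_mul_assoc, trace_smul, Complex.smul_re, smul_eq_mul]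
  apply le_antisymm
  · obtain ⟨τ, hτ, h⟩ := exists_schattenNorm_eq_re_trace_mul_rpow hα hcX
    rw [h, hlin]
    exact mul_le_mul_of_nonneg_left (re_trace_mul_rpow_le_schattenNorm hα hX hτ) hc
  · obtain ⟨τ, hτ, h⟩ := exists_schattenNorm_eq_re_trace_mul_rpow hα hX
    rw [h, ← hlin]
    exact re_trace_mul_rpow_le_schattenNorm hα hcX hτ

/-- The maximally mixed state. -/
noncomputable def maximallyMixed (n : Type*) [Fintype n] [DecidableEq n] : Matrix n n ℂ :=
  ((Fintype.card n : ℝ)⁻¹) • (1 : Matrix n n ℂ)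

theorem maximallyMixed_mem [Nonempty n] : maximallyMixed n ∈ densityOperators n := by
  refine ⟨PosSemidef.one.smul (by positivity), ?_⟩
  rw [maximallyMixed, trace_smul, trace_one, Complex.real_smul]
  push_cast
  exact inv_mul_cancel₀ (by exact_mod_cast Fintype.card_ne_zero)

end Schatten

/-! ### Lieb's concavity theorem -/

section Concavity

variable {n : Type*} [Fintype n] [DecidableEq n]

/-- Up to the factor `t^(p-2)`, `b · rpowIntegrand₀₁ p t (a / b)` is the parallel sum of `a` and
`t b`, and hence bounds from below the cost of each splitting `x + y`. For `b = 0` both are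
zero, thanks to `a / 0 = 0`. -/
theorem normSq_add_mul_le {a b : ℝ} (ha : 0 ≤ a) (hb : 0 ≤ b) {p t : ℝ}
    (hp : p ∈ Set.Ioo (0 : ℝ) 1) (ht : 0 < t) (x y : ℂ) :
    b * Real.rpowIntegrand₀₁ p t (a / b) * Complex.normSq (x + y) ≤
      t ^ (p - 2) * (a * Complex.normSq x + t * (b * Complex.normSq y)) := by
  have htp : 0 < t ^ (p - 2) := Real.rpow_pos_of_pos ht _
  rcases hb.eq_or_lt with rfl | hb
  · rw [zero_mul, zero_mul]
    exact mul_nonneg htp.le (by have := Complex.normSq_nonneg x; simp; positivity)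
  · have hden : 0 < t * b + a := by positivity
    rw [Real.rpowIntegrand₀₁_eq_pow_div hp ht.le (div_nonneg ha hb.le),
      show p - 1 = p - 2 + 1 by ring, Real.rpow_add ht, Real.rpow_one,
      show b * (t ^ (p - 2) * t * (a / b) / (t + a / b)) * Complex.normSq (x + y) =
        t ^ (p - 2) * (t * a * b * Complex.normSq (x + y) / (t * b + a)) by field_simp]
    refine mul_le_mul_of_nonneg_left ?_ htp.le
    rw [div_le_iff₀ hden]
    simp only [Complex.normSq_apply, Complex.add_re, Complex.add_im]
    nlinarith [sq_nonneg (a * x.re - t * b * y.re), sq_nonneg (a * x.im - t * b * y.im)]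

/-- The parallel sum is the cost of an optimal splitting. -/
theorem exists_add_eq_normSq_mul_eq {a b : ℝ} (ha : 0 ≤ a) (hb : 0 ≤ b) {p t : ℝ}
    (hp : p ∈ Set.Ioo (0 : ℝ) 1) (ht : 0 < t) (k : ℂ) :
    ∃ x y : ℂ, x + y = k ∧ b * Real.rpowIntegrand₀₁ p t (a / b) * Complex.normSq k =
      t ^ (p - 2) * (a * Complex.normSq x + t * (b * Complex.normSq y)) := by
  rcases hb.eq_or_lt with rfl | hb
  · exact ⟨0, k, by simp, by simp⟩
  · have hden : 0 < t * b + a := by positivity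
    refine ⟨((t * b / (t * b + a) : ℝ) : ℂ) * k, ((a / (t * b + a) : ℝ) : ℂ) * k, ?_, ?_⟩
    · rw [← add_mul, ← Complex.ofReal_add, ← add_div, div_self hden.ne', Complex.ofReal_one,
        one_mul]
    · rw [Real.rpowIntegrand₀₁_eq_pow_div hp ht.le (div_nonneg ha hb.le),
        show p - 1 = p - 2 + 1 by ring, Real.rpow_add ht, Real.rpow_one, Complex.normSq_mul,
        Complex.normSq_mul, Complex.normSq_ofReal, Complex.normSq_ofReal]
      field_simp

/-- `Tr A^p K B^(1-p) Kᴴ` is an integral over `t` of the minima, over the decompositions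
`K = X + Y`, of expressions which are affine in the pair `(A, B)`. -/
theorem exists_measure_re_trace_rpow_mul_rpow_eq_integral {p : ℝ} (hp : p ∈ Set.Ioo (0 : ℝ) 1) :
    ∃ μ : MeasureTheory.Measure ℝ, ∀ A B K : Matrix n n ℂ, A.PosSemidef → B.PosSemidef →
      ∃ g : ℝ → ℝ, MeasureTheory.IntegrableOn g (Set.Ioi 0) μ ∧
        (CFC.rpow A p * K * CFC.rpow B (1 - p) * Kᴴ).trace.re = ∫ t in Set.Ioi 0, g t ∂μ ∧
        ∀ t, 0 < t → IsLeast {r : ℝ | ∃ X Y : Matrix n n ℂ, X + Y = K ∧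
          r = t ^ (p - 2) * ((A * X * Xᴴ).trace.re + t * (Y * B * Yᴴ).trace.re)} (g t) := by
  obtain ⟨μ, hμ⟩ := Real.exists_measure_rpow_eq_integral_rpowIntegrand₀₁ hp
  refine ⟨μ, fun A B K hA hB => ?_⟩
  obtain ⟨U, hU, a, ha, rfl⟩ := exists_eq_conj_diagonal hA
  obtain ⟨V, hV, b, hb, rfl⟩ := exists_eq_conj_diagonal hB
  set k : Matrix n n ℂ := Uᴴ * K * V with hk
  have hUU : U * Uᴴ = 1 := mem_unitaryGroup_iff.1 hU
  have hVV : V * Vᴴ = 1 := mem_unitaryGroup_iff.1 hV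
  have hUU' : Uᴴ * U = 1 := mem_unitaryGroup_iff'.1 hU
  have hVV' : Vᴴ * V = 1 := mem_unitaryGroup_iff'.1 hV
  have hone : ∀ {W : Matrix n n ℂ}, W * Wᴴ = 1 →
      W * diagonal (fun _ => ((1 : ℝ) : ℂ)) * Wᴴ = 1 := fun h => by simpa using h
  have hX : ∀ X : Matrix n n ℂ, ((U * diagonal (fun i => (a i : ℂ)) * Uᴴ) * X * Xᴴ).trace.re =
      ∑ i, ∑ j, a i * Complex.normSq ((Uᴴ * X * V) i j) := fun X => by
    have := re_trace_conj_diagonal_mul U V a (fun _ => 1) X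
    rw [hone hVV, mul_one] at this
    simpa using this
  have hY : ∀ Y : Matrix n n ℂ, (Y * (V * diagonal (fun i => (b i : ℂ)) * Vᴴ) * Yᴴ).trace.re =
      ∑ i, ∑ j, b j * Complex.normSq ((Uᴴ * Y * V) i j) := fun Y => by
    have := re_trace_conj_diagonal_mul U V (fun _ => 1) b Y
    rw [hone hUU, one_mul] at this
    simpa using this
  have hab : ∀ i j, 0 ≤ a i / b j := fun i j => div_nonneg (ha i) (hb j)
  have hint : ∀ i j, MeasureTheory.IntegrableOn
      (fun t => b j * Real.rpowIntegrand₀₁ p t (a i / b j) * Complex.normSq (k i j))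
      (Set.Ioi 0) μ := fun i j => ((hμ _ (hab i j)).1.const_mul _).mul_const _
  have hsum : ∀ (X Y : Matrix n n ℂ) (t : ℝ),
      t ^ (p - 2) * (((U * diagonal (fun i => (a i : ℂ)) * Uᴴ) * X * Xᴴ).trace.re +
        t * (Y * (V * diagonal (fun i => (b i : ℂ)) * Vᴴ) * Yᴴ).trace.re) =
      ∑ i, ∑ j, t ^ (p - 2) * (a i * Complex.normSq ((Uᴴ * X * V) i j) +
        t * (b j * Complex.normSq ((Uᴴ * Y * V) i j))) := fun X Y t => by
    rw [hX, hY]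
    simp only [Finset.mul_sum, mul_add, Finset.sum_add_distrib]
  refine ⟨fun t => ∑ i, ∑ j,
    b j * Real.rpowIntegrand₀₁ p t (a i / b j) * Complex.normSq (k i j), ?_, ?_, ?_⟩
  · exact MeasureTheory.integrable_finsetSum _ fun i _ =>
      MeasureTheory.integrable_finsetSum _ fun j _ => hint i j
  · rw [rpow_conj_diagonal _ hU ha, rpow_conj_diagonal _ hV hb, re_trace_conj_diagonal_mul,
      MeasureTheory.integral_finsetSum _ fun i _ =>
        MeasureTheory.integrable_finsetSum _ fun j _ => hint i j]
    refine Finset.sum_congr rfl fun i _ => ?_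
    rw [MeasureTheory.integral_finsetSum _ fun j _ => hint i j]
    refine Finset.sum_congr rfl fun j _ => ?_
    rw [MeasureTheory.integral_mul_const, MeasureTheory.integral_const_mul, ← (hμ _ (hab i j)).2]
    congr 1
    rcases (hb j).eq_or_lt with h0 | h0
    · rw [← h0, Real.zero_rpow (by linarith [hp.2]), mul_zero, zero_mul]
    · rw [Real.div_rpow (ha i) h0.le, Real.rpow_sub h0, Real.rpow_one]
      ring
  · intro t ht
    constructor
    · choose x y hxy heq using fun i j => exists_add_eq_normSq_mul_eq (ha i) (hb j) hp ht (k i j)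
      have hrot : ∀ z : Matrix n n ℂ, Uᴴ * (U * z * Vᴴ) * V = z := fun z => by
        calc _ = (Uᴴ * U) * z * (Vᴴ * V) := by simp only [mul_assoc]
          _ = z := by rw [hUU', hVV', one_mul, mul_one]
      refine ⟨U * of x * Vᴴ, U * of y * Vᴴ, ?_, ?_⟩
      · rw [← add_mul, ← mul_add, show of x + of y = k from by ext i j; exact hxy i j, hk]
        calc _ = (U * Uᴴ) * K * (V * Vᴴ) := by simp only [mul_assoc]
          _ = K := by rw [hUU, hVV, one_mul, mul_one]
      · rw [hsum, hrot, hrot]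
        exact Finset.sum_congr rfl fun i _ => Finset.sum_congr rfl fun j _ => heq i j
    · rintro r ⟨X, Y, hXY, rfl⟩
      rw [hsum]
      refine Finset.sum_le_sum fun i _ => Finset.sum_le_sum fun j _ => ?_
      have : k i j = (Uᴴ * X * V) i j + (Uᴴ * Y * V) i j := by
        rw [hk, ← hXY, mul_add, add_mul, Matrix.add_apply]
      rw [this]
      exact normSq_add_mul_le (ha i) (hb j) hp ht _ _

/-- **Lieb's concavity theorem**, for exponents summing to one. -/
theorem concaveOn_re_trace_rpow_mul_rpow {p : ℝ} (hp : p ∈ Set.Ioo (0 : ℝ) 1)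
    (K : Matrix n n ℂ) :
    ConcaveOn ℝ {q : Matrix n n ℂ × Matrix n n ℂ | q.1.PosSemidef ∧ q.2.PosSemidef}
      fun q => (CFC.rpow q.1 p * K * CFC.rpow q.2 (1 - p) * Kᴴ).trace.re := by
  refine ⟨fun x hx y hy a b ha hb _ => ⟨(hx.1.smul ha).add (hy.1.smul hb),
    (hx.2.smul ha).add (hy.2.smul hb)⟩, ?_⟩
  rintro ⟨A₁, B₁⟩ ⟨hA₁, hB₁⟩ ⟨A₂, B₂⟩ ⟨hA₂, hB₂⟩ a b ha hb -
  simp only [Prod.smul_mk, Prod.mk_add_mk, smul_eq_mul]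
  obtain ⟨μ, hμ⟩ := exists_measure_re_trace_rpow_mul_rpow_eq_integral (n := n) hp
  obtain ⟨g₁, hi₁, he₁, hl₁⟩ := hμ A₁ B₁ K hA₁ hB₁
  obtain ⟨g₂, hi₂, he₂, hl₂⟩ := hμ A₂ B₂ K hA₂ hB₂
  obtain ⟨g, hi, he, hl⟩ := hμ (a • A₁ + b • A₂) (a • B₁ + b • B₂) K
    ((hA₁.smul ha).add (hA₂.smul hb)) ((hB₁.smul ha).add (hB₂.smul hb))
  rw [he₁, he₂, he, ← MeasureTheory.integral_const_mul, ← MeasureTheory.integral_const_mul,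
    ← MeasureTheory.integral_add (hi₁.const_mul a) (hi₂.const_mul b)]
  refine MeasureTheory.setIntegral_mono_on ((hi₁.const_mul a).add (hi₂.const_mul b)) hi
    measurableSet_Ioi fun t ht => ?_
  -- the optimal decomposition for the convex combination is admissible for both pairs
  obtain ⟨X, Y, hXY, hg⟩ := (hl t ht).1
  have h₁ := (hl₁ t ht).2 ⟨X, Y, hXY, rfl⟩
  have h₂ := (hl₂ t ht).2 ⟨X, Y, hXY, rfl⟩
  rw [hg]
  simp only [add_mul, mul_add, smul_mul_assoc, Matrix.mul_smul, trace_add,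
    trace_smul, Complex.add_re, Complex.smul_re, smul_eq_mul] at h₁ h₂ ⊢
  linarith [mul_le_mul_of_nonneg_left h₁ ha, mul_le_mul_of_nonneg_left h₂ hb]

end Concavity

/-! ### Operator convexity and continuity of real powers -/

section Convexity

variable {n : Type*} [Fintype n] [DecidableEq n]

open scoped Matrix.Norms.L2Operator in
/-- The power `σ ↦ σ^(p-1)` is operator convex on positive definite matrices: it is the inverse,
which is operator antitone and operator convex, of the operator concave function
`σ ↦ σ^(1-p)`. -/
theorem convexOn_rpow_sub_one {p : ℝ} (hp : p ∈ Set.Ioo (0 : ℝ) 1) :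
    ConvexOn ℝ {σ : Matrix n n ℂ | σ.PosDef} fun σ => CFC.rpow σ (p - 1) := by
  have hinv := CStarAlgebra.convexOn_ringInverse (A := Matrix n n ℂ)
  have hpow := CFC.concaveOn_rpow (A := Matrix n n ℂ) (p := 1 - p)
    ⟨by linarith [hp.2], by linarith [hp.1]⟩
  have hconv : Convex ℝ {σ : Matrix n n ℂ | σ.PosDef} := by
    simpa only [isStrictlyPositive_iff_posDef] using hinv.1
  have hrw : ∀ {σ : Matrix n n ℂ}, IsStrictlyPositive σ →
      CFC.rpow σ (p - 1) = Ring.inverse (σ ^ (1 - p)) := fun {σ} h => by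
    rw [CFC.inverse_rpow σ (1 - p) (by linarith [hp.2]) h, neg_sub]
    rfl
  refine ⟨hconv, fun x hx y hy a b ha hb hab => ?_⟩
  have hz : IsStrictlyPositive (a • x + b • y) :=
    isStrictlyPositive_iff_posDef.2 (hconv hx hy ha hb hab)
  replace hx : IsStrictlyPositive x := isStrictlyPositive_iff_posDef.2 hx
  replace hy : IsStrictlyPositive y := isStrictlyPositive_iff_posDef.2 hy
  have hxp : IsStrictlyPositive (x ^ (1 - p)) := IsStrictlyPositive.rpow x _ hx
  have hyp : IsStrictlyPositive (y ^ (1 - p)) := IsStrictlyPositive.rpow y _ hy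
  simp only [hrw hx, hrw hy, hrw hz]
  exact (CStarAlgebra.ringInverse_le_ringInverse (hpow.2 hx.nonneg hy.nonneg ha hb hab)
    (hinv.1 hxp hyp ha hb hab)).trans (hinv.2 hxp hyp ha hb hab)

open scoped Matrix.Norms.L2Operator in
theorem continuousOn_rpow_of_pos {s : ℝ} (hs : 0 < s) :
    ContinuousOn (fun M : Matrix n n ℂ => CFC.rpow M s) {M | M.PosSemidef} := by
  have h := CFC.continuousOn_nnrpow (A := Matrix n n ℂ) ⟨s, hs.le⟩
  simp only [nonneg_iff_posSemidef] at h
  refine h.congr fun M _ => ?_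
  exact (CFC.nnrpow_eq_rpow (a := M) (x := ⟨s, hs.le⟩) hs).symm

open scoped Matrix.Norms.L2Operator in
theorem continuousOn_rpow_posDef (s : ℝ) :
    ContinuousOn (fun M : Matrix n n ℂ => CFC.rpow M s) {M | M.PosDef} := by
  have := CFC.continuousOn_rpow (A := Matrix n n ℂ) s
  simp only [isStrictlyPositive_iff_posDef] at this
  exact this

end Convexity

/-! ### Operator inequalities -/

section Order

variable {n m : Type*} [Fintype n] [Fintype m]

theorem kronecker_le_kronecker_left {M : Matrix n n ℂ} (hM : M.PosSemidef) {N N' : Matrix m m ℂ}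
    (h : N ≤ N') : M ⊗ₖ N ≤ M ⊗ₖ N' := by
  rw [le_iff] at h ⊢
  have : M ⊗ₖ N' - M ⊗ₖ N = M ⊗ₖ (N' - N) := by
    ext i j
    simp [mul_sub]
  rw [this]
  exact hM.kronecker h

theorem mul_mul_le_mul_mul {H X Y : Matrix n n ℂ} (hH : Hᴴ = H) (h : X ≤ Y) :
    H * X * H ≤ H * Y * H := by
  rw [le_iff] at h ⊢
  have := h.mul_mul_conjTranspose_same H
  rwa [hH, mul_sub, sub_mul] at this

variable [DecidableEq n]

theorem conj_diagonal_le {U : Matrix n n ℂ} {x y : n → ℝ} (h : ∀ i, x i ≤ y i) :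
    U * diagonal (fun i => (x i : ℂ)) * Uᴴ ≤ U * diagonal (fun i => (y i : ℂ)) * Uᴴ := by
  rw [le_iff, ← sub_mul, ← mul_sub, diagonal_sub]
  have := posSemidef_conj_diagonal U (d := fun i => y i - x i) fun i => sub_nonneg.2 (h i)
  simpa only [Complex.ofReal_sub] using this

theorem smul_conj_diagonal (U : Matrix n n ℂ) (c : ℝ) (x : n → ℝ) :
    c • (U * diagonal (fun i => (x i : ℂ)) * Uᴴ) =
      U * diagonal (fun i => ((c * x i : ℝ) : ℂ)) * Uᴴ := by
  rw [← smul_mul_assoc, ← Matrix.mul_smul, ← diagonal_smul]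
  congr 3
  ext i
  simp

theorem add_conj_diagonal (U : Matrix n n ℂ) (x y : n → ℝ) :
    U * diagonal (fun i => (x i : ℂ)) * Uᴴ + U * diagonal (fun i => (y i : ℂ)) * Uᴴ =
      U * diagonal (fun i => ((x i + y i : ℝ) : ℂ)) * Uᴴ := by
  rw [← add_mul, ← mul_add, diagonal_add]
  congr 3
  ext i
  simp

end Order

/-! ### Mixtures with the maximally mixed state -/

section Mixing

variable {n : Type*} [Fintype n]

theorem convex_densityOperators : Convex ℝ (densityOperators n) := by
  intro x hx y hy a b ha hb hab
  refine ⟨(hx.1.smul ha).add (hy.1.smul hb), ?_⟩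
  rw [trace_add, trace_smul, trace_smul, hx.2, hy.2, ← add_smul, hab, one_smul]

variable [DecidableEq n]

/-- The mixture `(1 - t) σ + t 1/d` of `σ` with the maximally mixed state. -/
noncomputable def mixture (t : ℝ) (σ : Matrix n n ℂ) : Matrix n n ℂ :=
  (1 - t) • σ + t • maximallyMixed n

theorem mixture_mem [Nonempty n] {t : ℝ} (ht : t ∈ Set.Ioo (0 : ℝ) 1) {σ : Matrix n n ℂ}
    (hσ : σ ∈ densityOperators n) : mixture t σ ∈ densityOperators n :=
  convex_densityOperators hσ maximallyMixed_mem (by linarith [ht.2]) ht.1.le (by ring)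

theorem posDef_mixture [Nonempty n] {t : ℝ} (ht : t ∈ Set.Ioo (0 : ℝ) 1) {σ : Matrix n n ℂ}
    (hσ : σ.PosSemidef) : (mixture t σ).PosDef := by
  refine PosDef.posSemidef_add (hσ.smul (by linarith [ht.2])) ?_
  rw [maximallyMixed, smul_smul]
  exact PosDef.one.smul (mul_pos ht.1 (inv_pos.2 (by exact_mod_cast Fintype.card_pos)))

/-- With `P` the projection onto the kernel of `σ`, the powers `σ_t^(p-1)` of the mixtures `σ_t`
are comparable, up to factors that tend to `1` as `t → 0`, with `σ^(p-1)`, except for a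
multiple of `P` that is unbounded as `t → 0`. All the matrices involved commute, so these are
inequalities between eigenvalues. -/
theorem exists_kernelProjection [Nonempty n] {p : ℝ} (hp : p ∈ Set.Ioo (0 : ℝ) 1)
    {σ : Matrix n n ℂ} (hσ : σ.PosSemidef) :
    ∃ P : Matrix n n ℂ, ∃ κ : ℝ, 0 ≤ κ ∧ Pᴴ = P ∧ P * P = P ∧ σ * P = 0 ∧
      CFC.rpow σ (-1) * σ = 1 - P ∧ σ * CFC.rpow σ (-1) = 1 - P ∧
      ∀ t ∈ Set.Ioo (0 : ℝ) 1,
        CFC.rpow (mixture t σ) (p - 1) ≤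
          (1 - t) ^ (p - 1) • CFC.rpow σ (p - 1) + (t / Fintype.card n) ^ (p - 1) • P ∧
        (t / Fintype.card n) ^ (p - 1) • P ≤ CFC.rpow (mixture t σ) (p - 1) ∧
        (1 + t * κ) ^ (p - 1) • CFC.rpow σ (p - 1) ≤ CFC.rpow (mixture t σ) (p - 1) := by
  obtain ⟨V, hV, s, hs, rfl⟩ := exists_eq_conj_diagonal hσ
  have hcard : (0 : ℝ) < Fintype.card n := by exact_mod_cast Fintype.card_pos
  have hVV : V * Vᴴ = 1 := mem_unitaryGroup_iff.1 hV
  have hone : ∀ c : ℝ, c • (1 : Matrix n n ℂ) = V * diagonal (fun _ => (c : ℂ)) * Vᴴ := fun c => by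
    rw [← mul_one c, ← smul_conj_diagonal V c fun _ => 1]
    simp [hVV]
  set z : n → ℝ := fun i => if s i = 0 then 1 else 0 with hz
  set κ : ℝ := ∑ i, (Fintype.card n : ℝ)⁻¹ * (s i)⁻¹ with hκ
  have hterm : ∀ i, 0 ≤ (Fintype.card n : ℝ)⁻¹ * (s i)⁻¹ := fun i =>
    mul_nonneg (inv_nonneg.2 hcard.le) (inv_nonneg.2 (hs i))
  have hκ0 : 0 ≤ κ := Finset.sum_nonneg fun i _ => hterm i
  have hκs : ∀ i, s i ≠ 0 → (Fintype.card n : ℝ)⁻¹ ≤ κ * s i := fun i hi => by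
    have := Finset.single_le_sum (f := fun i => (Fintype.card n : ℝ)⁻¹ * (s i)⁻¹)
      (fun i _ => hterm i) (Finset.mem_univ i)
    calc (Fintype.card n : ℝ)⁻¹ = (Fintype.card n : ℝ)⁻¹ * (s i)⁻¹ * s i := by field_simp
      _ ≤ κ * s i := mul_le_mul_of_nonneg_right this (hs i)
  have hzz : (1 : Matrix n n ℂ) - V * diagonal (fun i => (z i : ℂ)) * Vᴴ =
      V * diagonal (fun i => ((1 - z i : ℝ) : ℂ)) * Vᴴ := by
    have h1 := hone 1
    rw [one_smul] at h1
    rw [sub_eq_iff_eq_add, add_conj_diagonal]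
    simpa using h1
  refine ⟨V * diagonal (fun i => (z i : ℂ)) * Vᴴ, κ, hκ0,
    (posSemidef_conj_diagonal V fun i => by simp only [hz]; split_ifs <;> norm_num).1,
    ?_, ?_, ?_, ?_, ?_⟩
  · rw [conj_mul_conj hV, diagonal_mul_diagonal]
    congr 3
    ext i
    simp only [hz]
    split_ifs <;> simp
  · rw [conj_mul_conj hV, diagonal_mul_diagonal]
    have : (fun i => (s i : ℂ) * (z i : ℂ)) = 0 := by
      ext i
      simp only [hz]
      split_ifs with h <;> simp [h]
    rw [this]
    simp
  · rw [hzz, rpow_conj_diagonal _ hV hs, conj_mul_conj hV, diagonal_mul_diagonal]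
    congr 3
    ext i
    rw [← Complex.ofReal_mul, Real.rpow_neg_one]
    simp only [hz]
    split_ifs with h <;> simp [h]
  · rw [hzz, rpow_conj_diagonal _ hV hs, conj_mul_conj hV, diagonal_mul_diagonal]
    congr 3
    ext i
    rw [← Complex.ofReal_mul, Real.rpow_neg_one]
    simp only [hz]
    split_ifs with h <;> simp [h]
  · intro t ht
    have ht1 : 0 < 1 - t := by linarith [ht.2]
    have htd : 0 < t / Fintype.card n := div_pos ht.1 hcard
    have hp1 : p - 1 < 0 := by linarith [hp.2]
    have hmix : mixture t (V * diagonal (fun i => (s i : ℂ)) * Vᴴ) =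
        V * diagonal (fun i => (((1 - t) * s i + t / Fintype.card n : ℝ) : ℂ)) * Vᴴ := by
      rw [mixture, maximallyMixed, smul_smul, hone, smul_conj_diagonal, add_conj_diagonal]
      rfl
    have hpos : ∀ i, 0 < (1 - t) * s i + t / Fintype.card n := fun i =>
      add_pos_of_nonneg_of_pos (mul_nonneg ht1.le (hs i)) htd
    rw [hmix, rpow_conj_diagonal _ hV hs, rpow_conj_diagonal _ hV fun i => (hpos i).le,
      smul_conj_diagonal, smul_conj_diagonal, smul_conj_diagonal, add_conj_diagonal]
    refine ⟨conj_diagonal_le fun i => ?_, conj_diagonal_le fun i => ?_,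
      conj_diagonal_le fun i => ?_⟩
    · simp only [hz]
      split_ifs with h
      · simp [h, Real.zero_rpow hp1.ne]
      · have hsi : 0 < s i := lt_of_le_of_ne (hs i) (Ne.symm h)
        rw [mul_zero, add_zero, ← Real.mul_rpow ht1.le hsi.le]
        exact Real.rpow_le_rpow_of_nonpos (mul_pos ht1 hsi) (by linarith) hp1.le
    · simp only [hz]
      split_ifs with h
      · simp [h]
      · rw [mul_zero]
        exact Real.rpow_nonneg (hpos i).le _
    · have hk : 0 < 1 + t * κ := by have := mul_nonneg ht.1.le hκ0; linarith
      by_cases h : s i = 0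
      · have h0 := Real.rpow_nonneg (hpos i).le (p - 1)
        rw [h] at h0 ⊢
        rwa [Real.zero_rpow hp1.ne, mul_zero]
      · have hsi : 0 < s i := lt_of_le_of_ne (hs i) (Ne.symm h)
        rw [← Real.mul_rpow hk.le hsi.le]
        refine Real.rpow_le_rpow_of_nonpos (hpos i) ?_ hp1.le
        have := mul_le_mul_of_nonneg_left (hκs i h) ht.1.le
        rw [← div_eq_mul_inv] at this
        nlinarith [mul_nonneg ht.1.le hsi.le]

end Mixing

/-! ### The support condition and the divergence as a Schatten norm -/

section Support

variable {A B : Type*} [Fintype A] [DecidableEq A] [Fintype B] [DecidableEq B]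

/-- The matrix `Γ^(1/2) (ρ^p ⊗ σ^(p-1)) Γ^(1/2)`. For `p = 1/α` its Schatten `α`-norm determines
the divergence of `ρ^(1/2) Γ ρ^(1/2)` relative to `ρ ⊗ σ`. -/
noncomputable def sandwichedChoi (p : ℝ) (Γ : Matrix (A × B) (A × B) ℂ) (ρ : Matrix A A ℂ)
    (σ : Matrix B B ℂ) : Matrix (A × B) (A × B) ℂ :=
  CFC.rpow Γ (1 / 2) * (CFC.rpow ρ p ⊗ₖ CFC.rpow σ (p - 1)) * CFC.rpow Γ (1 / 2)

/-- The operator `ρ^(1/2) Γ ρ^(1/2)`; for `Γ = choi N` it is `channelState N ρ`, by definition. -/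
noncomputable def sandwichedState (Γ : Matrix (A × B) (A × B) ℂ) (ρ : Matrix A A ℂ) :
    Matrix (A × B) (A × B) ℂ :=
  (CFC.rpow ρ (1 / 2) ⊗ₖ (1 : Matrix B B ℂ)) * Γ * (CFC.rpow ρ (1 / 2) ⊗ₖ (1 : Matrix B B ℂ))

variable {Γ : Matrix (A × B) (A × B) ℂ} {ρ : Matrix A A ℂ} {σ : Matrix B B ℂ}

theorem posSemidef_conj_sqrt (Γ : Matrix (A × B) (A × B) ℂ) {X : Matrix (A × B) (A × B) ℂ}
    (hX : X.PosSemidef) : (CFC.rpow Γ (1 / 2) * X * CFC.rpow Γ (1 / 2)).PosSemidef := by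
  simpa only [conjTranspose_rpow] using hX.mul_mul_conjTranspose_same (CFC.rpow Γ (1 / 2))

theorem posSemidef_sandwichedChoi (p : ℝ) (Γ : Matrix (A × B) (A × B) ℂ) (ρ : Matrix A A ℂ)
    (σ : Matrix B B ℂ) : (sandwichedChoi p Γ ρ σ).PosSemidef :=
  posSemidef_conj_sqrt Γ ((posSemidef_rpow ρ p).kronecker (posSemidef_rpow σ _))

theorem sqrt_mul_sqrt {n : Type*} [Fintype n] [DecidableEq n] {M : Matrix n n ℂ}
    (hM : M.PosSemidef) : CFC.rpow M (1 / 2) * CFC.rpow M (1 / 2) = M := by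
  rw [rpow_mul_rpow hM (by norm_num), add_halves, rpow_one_eq hM]

theorem sandwichedState_eq (hΓ : Γ.PosSemidef) :
    sandwichedState Γ ρ =
      (CFC.rpow Γ (1 / 2) * (CFC.rpow ρ (1 / 2) ⊗ₖ (1 : Matrix B B ℂ)))ᴴ *
        (CFC.rpow Γ (1 / 2) * (CFC.rpow ρ (1 / 2) ⊗ₖ (1 : Matrix B B ℂ))) := by
  rw [conjTranspose_mul, conjTranspose_kronecker, conjTranspose_rpow, conjTranspose_rpow,
    conjTranspose_one, sandwichedState]
  nth_rewrite 1 [← sqrt_mul_sqrt hΓ]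
  simp only [mul_assoc]

/-- `Γ^(1/2) (ρ^s ⊗ Q)` vanishes for one nonzero exponent `s` if and only if it does for all of
them. -/
theorem sqrt_mul_rpow_kronecker_eq_zero (hρ : ρ.PosSemidef) {s t : ℝ} (ht : t ≠ 0)
    {Q : Matrix B B ℂ} (h : CFC.rpow Γ (1 / 2) * (CFC.rpow ρ s ⊗ₖ Q) = 0) :
    CFC.rpow Γ (1 / 2) * (CFC.rpow ρ t ⊗ₖ Q) = 0 := by
  have : CFC.rpow ρ t ⊗ₖ Q = (CFC.rpow ρ s ⊗ₖ Q) * (CFC.rpow ρ (t - s) ⊗ₖ (1 : Matrix B B ℂ)) := by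
    rw [← mul_kronecker_mul, rpow_mul_rpow hρ (by simpa using ht), add_sub_cancel, mul_one]
  rw [this, ← mul_assoc, h, zero_mul]

theorem mul_eq_zero_of_supportLE {n : Type*} [Fintype n] [DecidableEq n] {X Y M : Matrix n n ℂ}
    (h : SupportLE X Y) (hM : Y * M = 0) : X * M = 0 := by
  ext i j
  have := h (M.col j) (by ext k; exact congrFun (congrFun hM k) j)
  exact congrFun this i

/-- The support condition in terms of a projection `P` onto the kernel of `σ`; the inverse `S` of
`σ` on its support is used to split off the component in `P`. -/
theorem supportLE_iff (hΓ : Γ.PosSemidef) (hρ : ρ.PosSemidef) {P S : Matrix B B ℂ}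
    (hσP : σ * P = 0) (hS : S * σ = 1 - P) :
    SupportLE (sandwichedState Γ ρ) (ρ ⊗ₖ σ) ↔
      CFC.rpow Γ (1 / 2) * (CFC.rpow ρ (1 / 2) ⊗ₖ P) = 0 := by
  set H := CFC.rpow Γ (1 / 2) with hH
  set R := CFC.rpow ρ (1 / 2) with hR
  have hN : H * (R ⊗ₖ P) = H * (R ⊗ₖ (1 : Matrix B B ℂ)) * ((1 : Matrix A A ℂ) ⊗ₖ P) := by
    rw [mul_assoc, ← mul_kronecker_mul, mul_one, one_mul]
  constructor
  · intro h
    have h0 : sandwichedState Γ ρ * ((1 : Matrix A A ℂ) ⊗ₖ P) = 0 :=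
      mul_eq_zero_of_supportLE h (by rw [← mul_kronecker_mul, hσP, kronecker_zero])
    rw [← conjTranspose_mul_self_eq_zero]
    rw [sandwichedState_eq hΓ] at h0
    rw [hN, conjTranspose_mul (H * _), mul_assoc, ← mul_assoc (H * _)ᴴ, h0, mul_zero]
  · intro h v hv
    set E := CFC.rpow ρ (-1) * ρ with hE
    have hRE : R * E = R := by
      have h1 : R * CFC.rpow ρ (-1) = CFC.rpow ρ (1 / 2 + -1) := rpow_mul_rpow hρ (by norm_num)
      have h2 := rpow_mul_rpow hρ (s := 1 / 2 + -1) (t := 1) (by norm_num)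
      rw [rpow_one_eq hρ] at h2
      rw [hE, ← mul_assoc, h1, h2, hR]
      norm_num
    have hEv : (E ⊗ₖ (1 - P)) *ᵥ v = 0 := by
      rw [hE, ← hS, mul_kronecker_mul, ← mulVec_mulVec, hv, mulVec_zero]
    have hdec : R ⊗ₖ (1 : Matrix B B ℂ) =
        (R ⊗ₖ (1 : Matrix B B ℂ)) * (E ⊗ₖ (1 - P)) + R ⊗ₖ P := by
      rw [← mul_kronecker_mul, hRE, one_mul, ← kronecker_add, sub_add_cancel]
    have : (H * (R ⊗ₖ (1 : Matrix B B ℂ))) *ᵥ v = 0 := by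
      rw [hdec, mul_add, h, add_zero, ← mul_assoc, ← mulVec_mulVec, hEv, mulVec_zero]
    rw [sandwichedState_eq hΓ, ← mulVec_mulVec, this, mulVec_zero]

theorem sqrt_mul_kronecker_mul_sqrt_eq_zero_iff (hρ : ρ.PosSemidef) {p : ℝ} (hp : 0 < p)
    {P : Matrix B B ℂ} (hP : Pᴴ = P) (hPP : P * P = P) :
    CFC.rpow Γ (1 / 2) * (CFC.rpow ρ p ⊗ₖ P) * CFC.rpow Γ (1 / 2) = 0 ↔
      CFC.rpow Γ (1 / 2) * (CFC.rpow ρ (1 / 2) ⊗ₖ P) = 0 := by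
  constructor
  · intro h
    refine sqrt_mul_rpow_kronecker_eq_zero hρ (s := p / 2) (by norm_num) ?_
    rw [← self_mul_conjTranspose_eq_zero, conjTranspose_mul, conjTranspose_kronecker,
      conjTranspose_rpow, conjTranspose_rpow, hP, mul_assoc, ← mul_assoc (_ ⊗ₖ _),
      ← mul_kronecker_mul, rpow_mul_rpow hρ (by linarith), add_halves, hPP, ← mul_assoc, h]
  · intro h
    rw [sqrt_mul_rpow_kronecker_eq_zero hρ hp.ne' h, zero_mul]

/-- Both matrices are of the form `Mᴴ M` and `M Mᴴ`, with
`M = Γ^(1/2) (ρ^(1/(2α)) ⊗ σ^((1-α)/(2α)))`. -/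
theorem trace_rpow_sandwich {α : ℝ} (hα : 1 < α) (hΓ : Γ.PosSemidef) (hρ : ρ.PosSemidef)
    (hσ : σ.PosSemidef) :
    (CFC.rpow (CFC.rpow (ρ ⊗ₖ σ) ((1 - α) / (2 * α)) * sandwichedState Γ ρ *
      CFC.rpow (ρ ⊗ₖ σ) ((1 - α) / (2 * α))) α).trace =
      (CFC.rpow (sandwichedChoi (1 / α) Γ ρ σ) α).trace := by
  have hα0 : α ≠ 0 := by linarith
  have hα1 : 1 - α ≠ 0 := by linarith
  set s := (1 - α) / (2 * α) with hs
  set M := CFC.rpow Γ (1 / 2) * (CFC.rpow ρ (1 / (2 * α)) ⊗ₖ CFC.rpow σ s) with hM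
  have hexp : 1 / 2 + s = 1 / (2 * α) := by rw [hs]; field_simp; ring
  have hne : (1 : ℝ) / (2 * α) ≠ 0 := by positivity
  have hR : (CFC.rpow ρ (1 / 2) ⊗ₖ (1 : Matrix B B ℂ)) * (CFC.rpow ρ s ⊗ₖ CFC.rpow σ s) =
      CFC.rpow ρ (1 / (2 * α)) ⊗ₖ CFC.rpow σ s := by
    rw [← mul_kronecker_mul, rpow_mul_rpow hρ (by rw [hexp]; exact hne), hexp, one_mul]
  have hL : (CFC.rpow ρ s ⊗ₖ CFC.rpow σ s) * (CFC.rpow ρ (1 / 2) ⊗ₖ (1 : Matrix B B ℂ)) =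
      CFC.rpow ρ (1 / (2 * α)) ⊗ₖ CFC.rpow σ s := by
    rw [← mul_kronecker_mul, rpow_mul_rpow hρ (by rw [add_comm, hexp]; exact hne), add_comm s, hexp,
      mul_one]
  have hMM : Mᴴ = (CFC.rpow ρ (1 / (2 * α)) ⊗ₖ CFC.rpow σ s) * CFC.rpow Γ (1 / 2) := by
    rw [hM, conjTranspose_mul, conjTranspose_kronecker, conjTranspose_rpow, conjTranspose_rpow,
      conjTranspose_rpow]
  have h1 : CFC.rpow (ρ ⊗ₖ σ) s * sandwichedState Γ ρ * CFC.rpow (ρ ⊗ₖ σ) s = Mᴴ * M := by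
    rw [rpow_kronecker hρ hσ, hMM, hM]
    nth_rewrite 2 [← hR]
    rw [← hL, sandwichedState]
    nth_rewrite 1 [← sqrt_mul_sqrt hΓ]
    simp only [mul_assoc]
  have h2 : sandwichedChoi (1 / α) Γ ρ σ = M * Mᴴ := by
    have e1 : (1 : ℝ) / (2 * α) + 1 / (2 * α) = 1 / α := by field_simp; norm_num
    have e2 : s + s = 1 / α - 1 := by rw [hs]; field_simp; ring
    have e3 : 1 / α - 1 ≠ 0 := by
      intro h
      have : (1 - α) / α = 0 := by rw [← h]; field_simp
      exact hα1 ((div_eq_zero_iff.1 this).resolve_right hα0)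
    rw [hMM, hM, mul_assoc, ← mul_assoc (_ ⊗ₖ _), ← mul_kronecker_mul,
      rpow_mul_rpow hρ (by rw [e1]; positivity), rpow_mul_rpow hσ (by rw [e2]; exact e3), e1, e2,
      sandwichedChoi, mul_assoc]
  rw [h1, h2, trace_rpow_conjTranspose_mul_comm]

/-- The divergence relative to `ρ ⊗ σ` in terms of the Schatten norm of `sandwichedChoi`. -/
theorem sandwichedRenyi_eq {α : ℝ} (hα : 1 < α) (hΓ : Γ.PosSemidef) (hρ : ρ.PosSemidef)
    (hσ : σ.PosSemidef) (hsupp : SupportLE (sandwichedState Γ ρ) (ρ ⊗ₖ σ)) :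
    sandwichedRenyi α (sandwichedState Γ ρ) (ρ ⊗ₖ σ) =
      ((1 / (α - 1) * Real.logb 2 (schattenNorm α (sandwichedChoi (1 / α) Γ ρ σ) ^ α) : ℝ) :
        EReal) := by
  rw [sandwichedRenyi, if_pos hsupp, trace_rpow_sandwich hα hΓ hρ hσ,
    re_trace_rpow_eq_schattenNorm_rpow hα]

/-- Positivity of the norm, so that the logarithm in the divergence is never the junk value at
zero. -/
theorem schattenNorm_sandwichedChoi_pos [Nonempty B] {α : ℝ} (hα : 1 < α) (hΓ : Γ.PosSemidef)
    (hρ : ρ.PosSemidef) (hσ : σ.PosSemidef)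
    (hsupp : SupportLE (sandwichedState Γ ρ) (ρ ⊗ₖ σ)) (h1 : sandwichedState Γ ρ ≠ 0) :
    0 < schattenNorm α (sandwichedChoi (1 / α) Γ ρ σ) := by
  have hα0 : 0 < α := by linarith
  refine lt_of_le_of_ne (schattenNorm_nonneg _ _) fun h0 => h1 ?_
  have hp : 1 / α ∈ Set.Ioo (0 : ℝ) 1 := ⟨by positivity, by rw [div_lt_one hα0]; exact hα⟩
  have htr : (CFC.rpow (sandwichedChoi (1 / α) Γ ρ σ) α).trace.re = 0 := by
    rw [re_trace_rpow_eq_schattenNorm_rpow hα, ← h0, Real.zero_rpow hα0.ne']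
  have hX := eq_zero_of_re_trace_rpow_eq_zero hα (posSemidef_sandwichedChoi _ _ _ _) htr
  obtain ⟨P, -, -, -, -, hσP, hS, hS', -⟩ := exists_kernelProjection hp hσ
  set p := 1 / α
  have hM : CFC.rpow Γ (1 / 2) * (CFC.rpow ρ (p / 2) ⊗ₖ CFC.rpow σ ((p - 1) / 2)) = 0 := by
    rw [← self_mul_conjTranspose_eq_zero, conjTranspose_mul, conjTranspose_kronecker,
      conjTranspose_rpow, conjTranspose_rpow, conjTranspose_rpow, mul_assoc,
      ← mul_assoc (_ ⊗ₖ _), ← mul_kronecker_mul, rpow_mul_rpow hρ (by linarith [hp.1]),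
      rpow_mul_rpow hσ (by linarith [hp.2]), add_halves, add_halves, ← mul_assoc]
    exact hX
  -- cancel the powers of `σ` on its support
  have hM' : CFC.rpow Γ (1 / 2) * (CFC.rpow ρ (p / 2) ⊗ₖ (1 - P)) = 0 := by
    have e : CFC.rpow σ ((p - 1) / 2) * (CFC.rpow σ (1 - (p - 1) / 2) * CFC.rpow σ (-1)) =
        1 - P := by
      rw [← mul_assoc, rpow_mul_rpow hσ (by norm_num), add_sub_cancel, rpow_one_eq hσ, hS']
    rw [← e, ← mul_one (CFC.rpow ρ (p / 2)), mul_kronecker_mul, ← mul_assoc, hM, zero_mul]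
  have hsum := congrArg₂ (· + ·)
    (sqrt_mul_rpow_kronecker_eq_zero hρ (t := 1 / 2) (by norm_num) hM')
    ((supportLE_iff hΓ hρ hσP hS).1 hsupp)
  simp only [← mul_add, ← kronecker_add, sub_add_cancel, add_zero] at hsum
  rw [sandwichedState_eq hΓ, hsum, mul_zero]

end Support

/-! ### Compactness of the set of density operators -/

section Compactness

variable {n : Type*} [Fintype n]

theorem isClosed_setOf_posSemidef : IsClosed {M : Matrix n n ℂ | M.PosSemidef} := by
  have : {M : Matrix n n ℂ | M.PosSemidef} =
      {M | Mᴴ = M} ∩ ⋂ x : n → ℂ, {M | 0 ≤ star x ⬝ᵥ (M *ᵥ x)} := by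
    ext M
    simp [posSemidef_iff_dotProduct_mulVec, IsHermitian]
  rw [this]
  refine IsClosed.inter (isClosed_eq (by fun_prop) (by fun_prop)) (isClosed_iInter fun x => ?_)
  refine isClosed_Ici.preimage (f := fun M : Matrix n n ℂ => star x ⬝ᵥ (M *ᵥ x)) ?_
  fun_prop

theorem isCompact_densityOperators [DecidableEq n] : IsCompact (densityOperators n) := by
  have hclosed : IsClosed (densityOperators n) :=
    isClosed_setOf_posSemidef.inter (isClosed_eq (by fun_prop) (by fun_prop))
  refine (isCompact_univ_pi fun i : n => isCompact_univ_pi fun j : n =>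
    isCompact_closedBall (0 : ℂ) 1).of_isClosed_subset hclosed ?_
  rintro M ⟨hM, htr⟩ i - j -
  obtain ⟨U, hU, d, hd, rfl⟩ := exists_eq_conj_diagonal hM
  have hsum : ∑ k, d k = 1 := by rw [← re_trace_conj_diagonal hU, htr, Complex.one_re]
  rw [mem_closedBall_zero_iff]
  calc ‖(U * diagonal (fun i => (d i : ℂ)) * Uᴴ) i j‖ = ‖∑ k, U i k * d k * star (U j k)‖ := by
        rw [mul_apply]
        simp only [mul_diagonal, conjTranspose_apply]
    _ ≤ ∑ k, ‖U i k * d k * star (U j k)‖ := norm_sum_le _ _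
    _ ≤ ∑ k, d k := Finset.sum_le_sum fun k _ => by
        rw [norm_mul, norm_mul, norm_star, Complex.norm_of_nonneg (hd k)]
        have h1 := entry_norm_bound_of_unitary hU i k
        have h2 := entry_norm_bound_of_unitary hU j k
        have h3 := mul_le_one₀ h1 (norm_nonneg _) h2
        nlinarith [hd k]
    _ = 1 := hsum

instance [DecidableEq n] : CompactSpace (densityOperators n) :=
  isCompact_iff_compactSpace.1 isCompact_densityOperators

instance [DecidableEq n] [Nonempty n] : Nonempty (densityOperators n) :=
  ⟨⟨_, maximallyMixed_mem⟩⟩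

end Compactness

/-! ### The Choi matrix of a channel -/

section Choi

variable {A B : Type*} [Fintype A] [DecidableEq A] {N : Matrix A A ℂ →ₗ[ℂ] Matrix B B ℂ}

theorem posSemidef_choi (hN : IsCompletelyPositive N) : (choi N).PosSemidef := by
  let e := Fintype.equivFin A
  have h := hN (Fintype.card A) ((maxEntangledOp A).submatrix (Prod.map e.symm id)
    (Prod.map e.symm id)) ((posSemidef_vecMulVec_self_star _).submatrix _)
  have h2 := h.submatrix (Prod.map e id : A × B → Fin (Fintype.card A) × B)
  convert h2 using 1
  ext x y
  simp [choi, idTensor, Prod.map]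

variable [Fintype B]

theorem traceB_choi (hN : IsTracePreserving N) : traceB (choi N) = 1 := by
  ext a a'
  have h := hN (of fun c c' => maxEntangledOp A (a, c) (a', c'))
  have h2 : (of fun c c' => maxEntangledOp A (a, c) (a', c')).trace = (1 : Matrix A A ℂ) a a' := by
    have hv : ∀ x y : A, maxEntangledVec A (x, y) = if x = y then 1 else 0 := by
      intro x y
      simp only [maxEntangledVec, Finset.sum_apply, Pi.single_apply, Prod.mk.injEq]
      by_cases hxy : x = y
      · subst hxy; simp
      · rw [if_neg hxy]
        exact Finset.sum_eq_zero fun i _ => if_neg fun ⟨h1, h2⟩ => hxy (h1.trans h2.symm)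
    simp [trace, maxEntangledOp, vecMulVec_apply, hv, one_apply]
  rw [← h2, ← h]
  rfl

theorem nonempty_of_isTracePreserving [Nonempty A] (hN : IsTracePreserving N) : Nonempty B := by
  by_contra hB
  rw [not_nonempty_iff] at hB
  have h := hN 1
  rw [trace_one] at h
  have h0 : (Fintype.card A : ℂ) = 0 := by simpa [trace] using h.symm
  exact Fintype.card_ne_zero (Nat.cast_eq_zero.1 h0)

variable [DecidableEq B]

theorem traceB_sandwichedState {Γ : Matrix (A × B) (A × B) ℂ} (hΓ : traceB Γ = 1)
    {ρ : Matrix A A ℂ} (hρ : ρ.PosSemidef) : traceB (sandwichedState Γ ρ) = ρ := by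
  have key : ∀ R : Matrix A A ℂ, traceB ((R ⊗ₖ (1 : Matrix B B ℂ)) * Γ *
      (R ⊗ₖ (1 : Matrix B B ℂ))) = R * traceB Γ * R := by
    intro R
    ext a a'
    simp only [traceB, of_apply, mul_apply, Fintype.sum_prod_type, kroneckerMap_apply, one_apply,
      mul_ite, mul_one, mul_zero, ite_mul, zero_mul, Finset.sum_ite_eq, Finset.sum_ite_eq',
      Finset.mem_univ, if_true, Finset.mul_sum, Finset.sum_mul]
    rw [Finset.sum_comm]
    refine Finset.sum_congr rfl fun c _ => ?_
    rw [Finset.sum_comm]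
  rw [sandwichedState, key, hΓ, mul_one, sqrt_mul_sqrt hρ]

theorem sandwichedState_ne_zero {Γ : Matrix (A × B) (A × B) ℂ} (hΓ : traceB Γ = 1)
    {ρ : Matrix A A ℂ} (hρ : ρ ∈ densityOperators A) : sandwichedState Γ ρ ≠ 0 := by
  intro h
  have h1 := traceB_sandwichedState hΓ hρ.1
  have h2 := hρ.2
  rw [← h1, h] at h2
  simp [traceB, trace] at h2

end Choi

/-! ### Continuity of the Schatten norm -/

section Continuity

variable {A B : Type*} [Fintype A] [DecidableEq A] [Fintype B] [DecidableEq B]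
  {Γ : Matrix (A × B) (A × B) ℂ}

theorem continuousOn_schattenNorm {n : Type*} [Fintype n] [DecidableEq n] {α : ℝ} (hα : 1 < α) :
    ContinuousOn (schattenNorm α : Matrix n n ℂ → ℝ) {M | M.PosSemidef} := by
  have h := continuousOn_rpow_of_pos (n := n) (s := α) (by linarith)
  refine ContinuousOn.rpow_const ?_ fun _ _ => Or.inr (by positivity)
  exact Complex.continuous_re.comp_continuousOn
    ((by fun_prop : Continuous fun M : Matrix n n ℂ => M.trace).comp_continuousOn h)

theorem continuous_kronecker {n m : Type*} :
    Continuous fun q : Matrix n n ℂ × Matrix m m ℂ => q.1 ⊗ₖ q.2 := by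
  refine continuous_matrix fun i j => ?_
  simp only [kroneckerMap_apply]
  exact (continuous_fst.matrix_elem _ _).mul (continuous_snd.matrix_elem _ _)

theorem continuousOn_sandwichedChoi_left {p : ℝ} (hp : 0 < p) (Γ : Matrix (A × B) (A × B) ℂ)
    (σ : Matrix B B ℂ) :
    ContinuousOn (fun ρ => sandwichedChoi p Γ ρ σ) {ρ | ρ.PosSemidef} := by
  have h := continuous_kronecker.comp_continuousOn
    ((continuousOn_rpow_of_pos (n := A) hp).prodMk (continuousOn_const (c := CFC.rpow σ (p - 1))))
  exact (continuousOn_const.mul h).mul continuousOn_const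

theorem continuousOn_sandwichedChoi_right (p : ℝ) (Γ : Matrix (A × B) (A × B) ℂ)
    (ρ : Matrix A A ℂ) :
    ContinuousOn (fun σ => sandwichedChoi p Γ ρ σ) {σ : Matrix B B ℂ | σ.PosDef} := by
  have h := continuous_kronecker.comp_continuousOn
    ((continuousOn_const (c := CFC.rpow ρ p)).prodMk (continuousOn_rpow_posDef (n := B) (p - 1)))
  exact (continuousOn_const.mul h).mul continuousOn_const

end Continuity

/-! ### The minimax step -/

section Minimax

variable {A B : Type*} [Fintype A] [DecidableEq A] [Fintype B] [DecidableEq B]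
  {Γ : Matrix (A × B) (A × B) ℂ}

/-- Lieb's theorem for `ρ ⊗ 1` and `τ`, the fixed power of `σ` being absorbed into `K`. -/
theorem concaveOn_re_trace_sandwichedChoi_mul_rpow {p : ℝ} (hp : p ∈ Set.Ioo (0 : ℝ) 1)
    {σ : Matrix B B ℂ} (hσ : σ.PosSemidef) :
    ConcaveOn ℝ {q : Matrix A A ℂ × Matrix (A × B) (A × B) ℂ | q.1.PosSemidef ∧ q.2.PosSemidef}
      fun q => (sandwichedChoi p Γ q.1 σ * CFC.rpow q.2 (1 - p)).trace.re := by
  set K := ((1 : Matrix A A ℂ) ⊗ₖ CFC.rpow σ ((p - 1) / 2)) * CFC.rpow Γ (1 / 2) with hK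
  let L : Matrix A A ℂ × Matrix (A × B) (A × B) ℂ →ₗ[ℝ]
      Matrix (A × B) (A × B) ℂ × Matrix (A × B) (A × B) ℂ :=
    { toFun := fun q => (q.1 ⊗ₖ (1 : Matrix B B ℂ), q.2)
      map_add' := fun x y => by simp [add_kronecker]
      map_smul' := fun c x => by simp [smul_kronecker] }
  have h := (concaveOn_re_trace_rpow_mul_rpow hp K).comp_linearMap L
  have hconv : Convex ℝ {q : Matrix A A ℂ × Matrix (A × B) (A × B) ℂ |
      q.1.PosSemidef ∧ q.2.PosSemidef} := fun x hx y hy a b ha hb _ =>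
    ⟨(hx.1.smul ha).add (hy.1.smul hb), (hx.2.smul ha).add (hy.2.smul hb)⟩
  refine (h.subset (fun q hq => ?_) hconv).congr fun q hq => ?_
  · exact ⟨hq.1.kronecker PosSemidef.one, hq.2⟩
  · change (CFC.rpow (q.1 ⊗ₖ (1 : Matrix B B ℂ)) p * K * CFC.rpow q.2 (1 - p) * Kᴴ).trace.re = _
    rw [rpow_kronecker hq.1 PosSemidef.one, one_rpow_eq, trace_mul_comm, ← mul_assoc, ← mul_assoc]
    congr 3
    have e : CFC.rpow q.1 p ⊗ₖ CFC.rpow σ (p - 1) =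
        ((1 : Matrix A A ℂ) ⊗ₖ CFC.rpow σ ((p - 1) / 2)) *
          (CFC.rpow q.1 p ⊗ₖ (1 : Matrix B B ℂ)) *
          ((1 : Matrix A A ℂ) ⊗ₖ CFC.rpow σ ((p - 1) / 2)) := by
      rw [← mul_kronecker_mul, ← mul_kronecker_mul, one_mul, mul_one, mul_one,
        rpow_mul_rpow hσ (by linarith [hp.2]), add_halves]
    rw [sandwichedChoi, e, hK, conjTranspose_mul, conjTranspose_kronecker, conjTranspose_rpow,
      conjTranspose_rpow, conjTranspose_one]
    simp only [mul_assoc]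

theorem convexOn_re_trace_sandwichedChoi_mul_rpow {p : ℝ} (hp : p ∈ Set.Ioo (0 : ℝ) 1)
    (ρ : Matrix A A ℂ) (τ : Matrix (A × B) (A × B) ℂ) :
    ConvexOn ℝ {σ : Matrix B B ℂ | σ.PosDef}
      fun σ => (sandwichedChoi p Γ ρ σ * CFC.rpow τ (1 - p)).trace.re := by
  have h := convexOn_rpow_sub_one (n := B) hp
  refine ⟨h.1, fun x hx y hy a b ha hb hab => ?_⟩
  have h1 := re_trace_mul_le_re_trace_mul (mul_mul_le_mul_mul (conjTranspose_rpow Γ (1 / 2))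
    (kronecker_le_kronecker_left (posSemidef_rpow ρ p) (h.2 hx hy ha hb hab)))
    (posSemidef_rpow τ (1 - p))
  refine h1.trans (le_of_eq ?_)
  simp only [sandwichedChoi, kronecker_add, kronecker_smul, mul_add, add_mul, Matrix.mul_smul,
    smul_mul_assoc, trace_add, trace_smul, Complex.add_re, Complex.smul_re]

/-- The minimax step. By Hölder duality the Schatten norm is the maximum over states `τ` of
`Tr Γ^(1/2) (ρ^p ⊗ σ^(p-1)) Γ^(1/2) τ^(1-p)`, which is jointly concave in `(ρ, τ)` and convex in
`σ`, so Sion's theorem applies, the pairs `(ρ, τ)` forming a compact set. -/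
theorem exists_forall_le_schattenNorm [Nonempty A] [Nonempty B] {α : ℝ} (hα : 1 < α)
    (Γ : Matrix (A × B) (A × B) ℂ) (c : ℝ)
    (h : ∀ σ ∈ densityOperators B, σ.PosDef →
      ∃ ρ ∈ densityOperators A, c ≤ schattenNorm α (sandwichedChoi (1 / α) Γ ρ σ)) :
    ∃ ρ ∈ densityOperators A, ∀ σ ∈ densityOperators B, σ.PosDef →
      c ≤ schattenNorm α (sandwichedChoi (1 / α) Γ ρ σ) := by
  have hα0 : 0 < α := by linarith
  set p := 1 / α with hp_def
  have hp : p ∈ Set.Ioo (0 : ℝ) 1 := ⟨by positivity, by rw [hp_def, div_lt_one hα0]; exact hα⟩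
  set X : Set (Matrix A A ℂ × Matrix (A × B) (A × B) ℂ) :=
    densityOperators A ×ˢ densityOperators (A × B) with hX
  set Y : Set (Matrix B B ℂ) := densityOperators B ∩ {σ | σ.PosDef} with hY
  -- Sion's theorem minimizes over the compact set, hence the sign
  set f : Matrix A A ℂ × Matrix (A × B) (A × B) ℂ → Matrix B B ℂ → ℝ := fun q σ =>
    -(sandwichedChoi p Γ q.1 σ * CFC.rpow q.2 (1 - p)).trace.re with hf
  have ne_X : X.Nonempty := ⟨(_, _), maximallyMixed_mem, maximallyMixed_mem⟩
  have cX : Convex ℝ X := convex_densityOperators.prod convex_densityOperators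
  have cY : Convex ℝ Y :=
    convex_densityOperators.inter (convexOn_rpow_sub_one (n := B) hp).1
  have kX : IsCompact X := isCompact_densityOperators.prod isCompact_densityOperators
  have hretr : Continuous fun M : Matrix (A × B) (A × B) ℂ => -M.trace.re :=
    (Complex.continuous_re.comp (by fun_prop)).neg
  have hfy : ∀ σ ∈ Y, LowerSemicontinuousOn (fun q => f q σ) X := fun σ hσ => by
    refine ContinuousOn.lowerSemicontinuousOn (hretr.comp_continuousOn (ContinuousOn.mul ?_ ?_))
    · exact (continuousOn_sandwichedChoi_left hp.1 Γ σ).comp continuousOn_fst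
        fun q hq => hq.1.1
    · exact (continuousOn_rpow_of_pos (n := A × B) (by linarith [hp.2])).comp continuousOn_snd
        fun q hq => hq.2.1
  have hfy' : ∀ σ ∈ Y, QuasiconvexOn ℝ X (fun q => f q σ) := fun σ hσ =>
    (((concaveOn_re_trace_sandwichedChoi_mul_rpow (Γ := Γ) hp hσ.1.1).subset
      (fun q hq => ⟨hq.1.1, hq.2.1⟩) cX).neg).quasiconvexOn
  have hfx : ∀ q ∈ X, UpperSemicontinuousOn (fun σ => f q σ) Y := fun q hq => by
    refine ContinuousOn.upperSemicontinuousOn (hretr.comp_continuousOn (ContinuousOn.mul ?_ ?_))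
    · exact (continuousOn_sandwichedChoi_right p Γ q.1).mono Set.inter_subset_right
    · exact continuousOn_const
  have hfx' : ∀ q ∈ X, QuasiconcaveOn ℝ Y (fun σ => f q σ) := fun q hq =>
    (((convexOn_re_trace_sandwichedChoi_mul_rpow (Γ := Γ) hp q.1 q.2).subset
      Set.inter_subset_right cY).neg).quasiconcaveOn
  suffices hmain : ∃ q ∈ X, ∀ σ ∈ Y, f q σ ≤ -c by
    obtain ⟨q, hq, hle⟩ := hmain
    refine ⟨q.1, hq.1, fun σ hσ hσ' => ?_⟩
    exact (neg_le_neg_iff.1 (hle σ ⟨hσ, hσ'⟩)).trans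
      (re_trace_mul_rpow_le_schattenNorm hα (posSemidef_sandwichedChoi _ _ _ _) hq.2)
  -- by compactness, a violation is witnessed by finitely many `σ`, hence by a single one
  by_contra! hcon
  obtain ⟨s, hs⟩ : ∃ s : Finset Y, ∀ q ∈ X, ∃ σ ∈ s, -c < f q σ := by
    rw [← LowerSemicontinuousOn.inter_biInter_preimage_Iic_eq_empty_iff_exists_finset kX hfy]
    refine Set.eq_empty_of_forall_notMem ?_
    rintro q ⟨hq, hq'⟩
    obtain ⟨σ, hσ, hlt⟩ := hcon q hq
    simp only [Set.mem_iInter, Set.mem_preimage, Set.mem_Iic] at hq'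
    exact hlt.not_ge (hq' σ hσ)
  obtain ⟨σ, hσ, hlt⟩ := Sion.exists_lt_iInf_of_lt_iInf_of_finite ne_X kX hfy hfy' cY hfx hfx' cX
    (s := Subtype.val '' (s : Set Y)) (t := -c) (Set.toFinite _) (Subtype.coe_image_subset Y _)
    (fun q hq => by
      obtain ⟨σ, hσ, hlt⟩ := hs q hq
      exact ⟨σ.1, ⟨σ, hσ, rfl⟩, hlt⟩)
  obtain ⟨ρ, hρ, hle⟩ := h σ hσ.1 hσ.2
  obtain ⟨τ, hτ, hτeq⟩ := exists_schattenNorm_eq_re_trace_mul_rpow hα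
    (posSemidef_sandwichedChoi p Γ ρ σ)
  have := hlt (ρ, τ) ⟨hρ, hτ⟩
  rw [hτeq] at hle
  exact absurd hle (not_le.2 (neg_lt_neg_iff.1 this))

end Minimax

/-! ### Minimax with values in the extended reals -/

section ExtendedReal

/-- A minimax principle for a function `D` with values in the extended reals, for which the
exchange is known only on a subset `S` of the second variable, on which `D` is continuous in the
first. Points of the second variable are approximated by maps `m i` into `S` that increase `D` by
at most the error `e i`, and `D` is controlled by its values at the approximating points. -/
theorem minimax_of_approximation {X Y ι : Type*} [TopologicalSpace X] [CompactSpace X] [Nonempty X]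
    [TopologicalSpace Y] [CompactSpace Y] [Nonempty Y] (D : X → Y → EReal) (S : Set Y)
    (m : ι → Y → Y) (e : ι → ℝ) (hm : ∀ i y, m i y ∈ S) (he : ∀ ε > 0, ∃ i, e i < ε)
    (hcont : ∀ y ∈ S, Continuous fun x => D x y)
    (hcont' : ∀ x i, Continuous fun y => D x (m i y))
    (hle : ∀ x y i, D x (m i y) ≤ D x y + (e i : EReal))
    (hge : ∀ x y (c : ℝ), (∀ i, D x (m i y) ≤ (c : EReal) + (e i : EReal)) → D x y ≤ c)
    (hminimax : ∀ c : ℝ, (∀ y ∈ S, ∃ x, (c : EReal) ≤ D x y) → ∃ x, ∀ y ∈ S, (c : EReal) ≤ D x y)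
    (hfin : ∀ y, (∀ x, D x y ≠ ⊤) → Continuous fun x => D x y) :
    (∀ x, IsLeast (Set.range fun y => D x y) (⨅ y, D x y)) ∧
    IsGreatest (Set.range fun x => ⨅ y, D x y) (⨆ x, ⨅ y, D x y) ∧
    (⨆ x, ⨅ y, D x y) = ⨅ y, ⨆ x, D x y ∧
    (∀ y, IsGreatest (Set.range fun x => D x y) (⨆ x, D x y)) ∧
    IsLeast (Set.range fun y => ⨆ x, D x y) (⨅ y, ⨆ x, D x y) := by
  have hlsc : ∀ x, LowerSemicontinuous fun y => D x y := by
    intro x y c hc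
    obtain ⟨r, hcr, hr⟩ := EReal.lt_iff_exists_real_btwn.1 hc
    have hset : {y | D x y ≤ (r : EReal)} =
        ⋂ i, {y | D x (m i y) ≤ (r : EReal) + (e i : EReal)} := by
      ext y
      simp only [Set.mem_iInter, Set.mem_ofPred_eq]
      exact ⟨fun h i => (hle x y i).trans (by gcongr), hge x y r⟩
    have hclosed : IsClosed {y | D x y ≤ (r : EReal)} := by
      rw [hset]
      exact isClosed_iInter fun i => isClosed_Iic.preimage (hcont' x i)
    filter_upwards [hclosed.isOpen_compl.mem_nhds (show y ∈ {y | D x y ≤ (r : EReal)}ᶜ from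
      not_le.2 hr)] with z hz
    exact hcr.trans (not_le.1 hz)
  have hmin : ∀ f : Y → EReal, LowerSemicontinuous f → IsLeast (Set.range f) (⨅ y, f y) := by
    intro f hf
    obtain ⟨y, -, hy⟩ := (hf.lowerSemicontinuousOn Set.univ).exists_isMinOn Set.univ_nonempty
      isCompact_univ
    refine ⟨⟨y, le_antisymm (le_iInf fun z => hy (Set.mem_univ z)) (iInf_le _ y)⟩, ?_⟩
    rintro _ ⟨z, rfl⟩
    exact iInf_le _ z
  have hmax : ∀ f : X → EReal, UpperSemicontinuous f → IsGreatest (Set.range f) (⨆ x, f x) := by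
    intro f hf
    obtain ⟨y, -, hy⟩ := (hf.upperSemicontinuousOn Set.univ).exists_isMaxOn Set.univ_nonempty
      isCompact_univ
    refine ⟨⟨y, le_antisymm (le_iSup _ y) (iSup_le fun z => hy (Set.mem_univ z))⟩, ?_⟩
    rintro _ ⟨z, rfl⟩
    exact le_iSup _ z
  -- the infimum over the second variable may be restricted to `S`
  have hS : ∀ x, ⨅ y, D x y = ⨅ y ∈ S, D x y := by
    intro x
    refine le_antisymm (le_iInf₂ fun y _ => iInf_le _ y) (le_iInf fun y => ?_)
    refine le_of_forall_gt fun c hc => ?_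
    obtain ⟨b, hyb, hbc⟩ := EReal.lt_iff_exists_real_btwn.1 hc
    obtain ⟨a, hya, hab⟩ := EReal.lt_iff_exists_real_btwn.1 hyb
    have hab' : a < b := EReal.coe_lt_coe_iff.1 hab
    obtain ⟨i, hi⟩ := he (b - a) (sub_pos.2 hab')
    calc ⨅ y ∈ S, D x y ≤ D x (m i y) := iInf₂_le _ (hm i y)
      _ ≤ D x y + (e i : EReal) := hle x y i
      _ ≤ (a : EReal) + (e i : EReal) := by gcongr
      _ ≤ b := by exact_mod_cast (by linarith : a + e i ≤ b)
      _ < c := hbc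
  have husc : UpperSemicontinuous fun x => ⨅ y, D x y := by
    simp only [hS]
    exact upperSemicontinuous_biInf fun y hy => (hcont y hy).upperSemicontinuous
  refine ⟨fun x => hmin _ (hlsc x), hmax _ husc, ?_, fun y => ?_,
    hmin _ (lowerSemicontinuous_iSup hlsc)⟩
  · refine le_antisymm (iSup_iInf_le_iInf_iSup _) (le_of_forall_lt fun c hc => ?_)
    obtain ⟨b, hcb, hb⟩ := EReal.lt_iff_exists_real_btwn.1 hc
    obtain ⟨x, hx⟩ := hminimax b fun y _ => by
      obtain ⟨x, hx⟩ := lt_iSup_iff.1 (hb.trans_le (iInf_le _ y))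
      exact ⟨x, hx.le⟩
    refine hcb.trans_le (le_trans ?_ (le_iSup _ x))
    rw [hS]
    exact le_iInf₂ hx
  · by_cases h : ∀ x, D x y ≠ ⊤
    · exact hmax _ (hfin y h).upperSemicontinuous
    · push Not at h
      obtain ⟨x, hx⟩ := h
      refine ⟨⟨x, le_antisymm (le_iSup (fun x => D x y) x) ?_⟩, ?_⟩
      · simp only [hx, le_top]
      · rintro _ ⟨z, rfl⟩
        exact le_iSup (fun x => D x y) z

end ExtendedReal

/-! ### The divergence on singular and mixed states -/

section Divergence

variable {A B : Type*} [Fintype A] [DecidableEq A] [Fintype B] [DecidableEq B]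
  {Γ : Matrix (A × B) (A × B) ℂ}

/-- The divergence of `ρ^(1/2) Γ ρ^(1/2)` relative to `ρ ⊗ σ`. -/
noncomputable def choiDivergence (α : ℝ) (Γ : Matrix (A × B) (A × B) ℂ) (ρ : Matrix A A ℂ)
    (σ : Matrix B B ℂ) : EReal :=
  sandwichedRenyi α (sandwichedState Γ ρ) (ρ ⊗ₖ σ)

theorem choiDivergence_eq {α : ℝ} (hα : 1 < α) (hΓ : Γ.PosSemidef) {ρ : Matrix A A ℂ}
    (hρ : ρ.PosSemidef) {σ : Matrix B B ℂ} (hσ : σ.PosSemidef)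
    (hsupp : SupportLE (sandwichedState Γ ρ) (ρ ⊗ₖ σ)) :
    choiDivergence α Γ ρ σ =
      ((α / (α - 1) * Real.logb 2 (schattenNorm α (sandwichedChoi (1 / α) Γ ρ σ)) : ℝ) :
        EReal) := by
  rw [choiDivergence, sandwichedRenyi_eq hα hΓ hρ hσ hsupp]
  congr 1
  rcases (schattenNorm_nonneg α (sandwichedChoi (1 / α) Γ ρ σ)).eq_or_lt with h | h
  · rw [← h, Real.zero_rpow (by linarith)]
    simp
  · rw [Real.logb_rpow_eq_mul_logb_of_pos h]
    ring

theorem supportLE_of_choiDivergence_ne_top {α : ℝ} {ρ : Matrix A A ℂ} {σ : Matrix B B ℂ}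
    (h : choiDivergence α Γ ρ σ ≠ ⊤) : SupportLE (sandwichedState Γ ρ) (ρ ⊗ₖ σ) := by
  by_contra hs
  exact h (if_neg hs)

theorem supportLE_of_posDef [Nonempty B] (hΓ : Γ.PosSemidef) {ρ : Matrix A A ℂ}
    (hρ : ρ.PosSemidef) {σ : Matrix B B ℂ} (hσ : σ.PosDef) :
    SupportLE (sandwichedState Γ ρ) (ρ ⊗ₖ σ) := by
  obtain ⟨P, -, -, -, -, hσP, hS, -⟩ :=
    exists_kernelProjection (p := 1 / 2) ⟨by norm_num, by norm_num⟩ hσ.posSemidef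
  rw [supportLE_iff hΓ hρ hσP hS, hσ.isUnit.mul_right_eq_zero.1 hσP, kronecker_zero, mul_zero]

theorem sandwichedChoi_mono {p : ℝ} (Γ : Matrix (A × B) (A × B) ℂ) (ρ : Matrix A A ℂ)
    {S T : Matrix B B ℂ} (h : S ≤ T) :
    CFC.rpow Γ (1 / 2) * (CFC.rpow ρ p ⊗ₖ S) * CFC.rpow Γ (1 / 2) ≤
      CFC.rpow Γ (1 / 2) * (CFC.rpow ρ p ⊗ₖ T) * CFC.rpow Γ (1 / 2) :=
  mul_mul_le_mul_mul (conjTranspose_rpow Γ _) (kronecker_le_kronecker_left (posSemidef_rpow ρ p) h)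

theorem one_div_mem_Ioo {α : ℝ} (hα : 1 < α) : 1 / α ∈ Set.Ioo (0 : ℝ) 1 :=
  ⟨by positivity, by rw [div_lt_one (by linarith)]; exact hα⟩

variable [Nonempty B]

theorem schattenNorm_sandwichedChoi_pos_of_mem {α : ℝ} (hα : 1 < α) (hΓ : Γ.PosSemidef)
    (hΓ1 : traceB Γ = 1) {ρ : Matrix A A ℂ} (hρ : ρ ∈ densityOperators A) {σ : Matrix B B ℂ}
    (hσ : σ.PosSemidef) (hsupp : SupportLE (sandwichedState Γ ρ) (ρ ⊗ₖ σ)) :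
    0 < schattenNorm α (sandwichedChoi (1 / α) Γ ρ σ) :=
  schattenNorm_sandwichedChoi_pos hα hΓ hρ.1 hσ hsupp (sandwichedState_ne_zero hΓ1 hρ)

theorem continuous_choiDivergence_left {α : ℝ} (hα : 1 < α) (hΓ : Γ.PosSemidef)
    (hΓ1 : traceB Γ = 1) {σ : Matrix B B ℂ} (hσ : σ.PosSemidef)
    (hsupp : ∀ ρ ∈ densityOperators A, SupportLE (sandwichedState Γ ρ) (ρ ⊗ₖ σ)) :
    Continuous fun ρ : densityOperators A => choiDivergence α Γ ρ.1 σ := by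
  have heq : (fun ρ : densityOperators A => choiDivergence α Γ ρ.1 σ) = fun ρ =>
      ((α / (α - 1) * Real.logb 2 (schattenNorm α (sandwichedChoi (1 / α) Γ ρ.1 σ)) : ℝ) :
        EReal) :=
    funext fun ρ => choiDivergence_eq hα hΓ ρ.2.1 hσ (hsupp ρ.1 ρ.2)
  rw [heq]
  have hc : Continuous fun ρ : densityOperators A =>
      schattenNorm α (sandwichedChoi (1 / α) Γ ρ.1 σ) :=
    (continuousOn_schattenNorm hα).comp_continuous
      ((continuousOn_sandwichedChoi_left (one_div_mem_Ioo hα).1 Γ σ).comp_continuous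
        continuous_subtype_val fun ρ => ρ.2.1) fun ρ => posSemidef_sandwichedChoi _ _ _ _
  refine continuous_coe_real_ereal.comp (continuous_const.mul ?_)
  exact (hc.log fun ρ => (schattenNorm_sandwichedChoi_pos_of_mem hα hΓ hΓ1 ρ.2 hσ
    (hsupp ρ.1 ρ.2)).ne').div_const _

theorem continuous_choiDivergence_mixture {α : ℝ} (hα : 1 < α) (hΓ : Γ.PosSemidef)
    (hΓ1 : traceB Γ = 1) {ρ : Matrix A A ℂ} (hρ : ρ ∈ densityOperators A) {t : ℝ}
    (ht : t ∈ Set.Ioo (0 : ℝ) 1) :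
    Continuous fun σ : densityOperators B => choiDivergence α Γ ρ (mixture t σ.1) := by
  have hpd : ∀ σ : densityOperators B, (mixture t σ.1).PosDef := fun σ => posDef_mixture ht σ.2.1
  have heq : (fun σ : densityOperators B => choiDivergence α Γ ρ (mixture t σ.1)) = fun σ =>
      ((α / (α - 1) * Real.logb 2 (schattenNorm α (sandwichedChoi (1 / α) Γ ρ (mixture t σ.1)))
        : ℝ) : EReal) :=
    funext fun σ => choiDivergence_eq hα hΓ hρ.1 (hpd σ).posSemidef
      (supportLE_of_posDef hΓ hρ.1 (hpd σ))
  rw [heq]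
  have hmix : Continuous fun σ : densityOperators B => mixture t σ.1 :=
    (continuous_subtype_val.const_smul (1 - t)).add continuous_const
  have hc : Continuous fun σ : densityOperators B =>
      schattenNorm α (sandwichedChoi (1 / α) Γ ρ (mixture t σ.1)) :=
    (continuousOn_schattenNorm hα).comp_continuous
      ((continuousOn_sandwichedChoi_right (1 / α) Γ ρ).comp_continuous hmix hpd)
      fun σ => posSemidef_sandwichedChoi _ _ _ _
  refine continuous_coe_real_ereal.comp (continuous_const.mul ?_)
  exact (hc.log fun σ => (schattenNorm_sandwichedChoi_pos_of_mem hα hΓ hΓ1 hρ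
    (hpd σ).posSemidef (supportLE_of_posDef hΓ hρ.1 (hpd σ))).ne').div_const _

theorem coe_le_choiDivergence_iff {α : ℝ} (hα : 1 < α) (hΓ : Γ.PosSemidef) (hΓ1 : traceB Γ = 1)
    {ρ : Matrix A A ℂ} (hρ : ρ ∈ densityOperators A) {σ : Matrix B B ℂ} (hσ : σ.PosDef) (c : ℝ) :
    (c : EReal) ≤ choiDivergence α Γ ρ σ ↔
      (2 : ℝ) ^ ((α - 1) / α * c) ≤ schattenNorm α (sandwichedChoi (1 / α) Γ ρ σ) := by
  have hs := supportLE_of_posDef hΓ hρ.1 hσ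
  rw [choiDivergence_eq hα hΓ hρ.1 hσ.posSemidef hs, EReal.coe_le_coe_iff,
    ← Real.le_logb_iff_rpow_le one_lt_two
      (schattenNorm_sandwichedChoi_pos_of_mem hα hΓ hΓ1 hρ hσ.posSemidef hs)]
  have h1 : 0 < α - 1 := by linarith
  have h0 : 0 < α := by linarith
  rw [div_mul_eq_mul_div, div_mul_eq_mul_div, le_div_iff₀ h1, div_le_iff₀ h0, mul_comm c,
    mul_comm α]

/-- A factor `u^(1/α - 1)` in the norm shifts the divergence by `- log₂ u`. -/
theorem mul_logb_rpow {α : ℝ} (hα : 1 < α) {u x : ℝ} (hu : 0 < u) (hx : 0 < x) :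
    α / (α - 1) * Real.logb 2 (u ^ (1 / α - 1) * x) =
      α / (α - 1) * Real.logb 2 x - Real.logb 2 u := by
  have h1 : α - 1 ≠ 0 := by linarith
  have h0 : α ≠ 0 := by linarith
  rw [Real.logb_mul (Real.rpow_pos_of_pos hu _).ne' hx.ne',
    Real.logb_rpow_eq_mul_logb_of_pos hu]
  field_simp
  ring

variable [Nonempty A]

/-- Mixing `σ` with the maximally mixed state costs at most `- log₂ (1 - t)`. -/
theorem choiDivergence_mixture_le {α : ℝ} (hα : 1 < α) (hΓ : Γ.PosSemidef) (hΓ1 : traceB Γ = 1)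
    {ρ : Matrix A A ℂ} (hρ : ρ ∈ densityOperators A) {σ : Matrix B B ℂ} (hσ : σ.PosSemidef)
    {t : ℝ} (ht : t ∈ Set.Ioo (0 : ℝ) 1) :
    choiDivergence α Γ ρ (mixture t σ) ≤
      choiDivergence α Γ ρ σ + ((-Real.logb 2 (1 - t) : ℝ) : EReal) := by
  by_cases htop : choiDivergence α Γ ρ σ = ⊤
  · rw [htop, EReal.top_add_coe]
    exact le_top
  have hsupp := supportLE_of_choiDivergence_ne_top htop
  have hpd := posDef_mixture ht hσ
  have hsupp' := supportLE_of_posDef hΓ hρ.1 hpd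
  have h1t : 0 < 1 - t := by linarith [ht.2]
  obtain ⟨P, κ, -, hP, hPP, hσP, hS, -, hmix⟩ := exists_kernelProjection (one_div_mem_Ioo hα) hσ
  obtain ⟨hup, -, -⟩ := hmix t ht
  have hZ := (sqrt_mul_kronecker_mul_sqrt_eq_zero_iff (Γ := Γ) hρ.1 (one_div_mem_Ioo hα).1 hP
    hPP).2 ((supportLE_iff hΓ hρ.1 hσP hS).1 hsupp)
  have hX : sandwichedChoi (1 / α) Γ ρ (mixture t σ) ≤
      (1 - t) ^ (1 / α - 1) • sandwichedChoi (1 / α) Γ ρ σ := by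
    refine (sandwichedChoi_mono Γ ρ hup).trans (le_of_eq ?_)
    rw [kronecker_add, kronecker_smul, kronecker_smul, mul_add, add_mul, Matrix.mul_smul,
      Matrix.mul_smul, smul_mul_assoc, smul_mul_assoc, hZ, smul_zero, add_zero, sandwichedChoi]
  have hG := schattenNorm_mono hα (posSemidef_sandwichedChoi _ _ _ _) hX
  rw [schattenNorm_smul hα (posSemidef_sandwichedChoi _ _ _ _) (Real.rpow_nonneg h1t.le _)] at hG
  rw [choiDivergence_eq hα hΓ hρ.1 hσ hsupp, choiDivergence_eq hα hΓ hρ.1 hpd.posSemidef hsupp',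
    ← EReal.coe_add, EReal.coe_le_coe_iff, ← sub_eq_add_neg, ← mul_logb_rpow hα h1t
      (schattenNorm_sandwichedChoi_pos_of_mem hα hΓ hΓ1 hρ hσ hsupp)]
  refine mul_le_mul_of_nonneg_left ?_ (div_nonneg (by linarith) (by linarith))
  exact Real.logb_le_logb_of_le one_lt_two
    (schattenNorm_sandwichedChoi_pos_of_mem hα hΓ hΓ1 hρ hpd.posSemidef hsupp') hG

/-- The divergence is controlled by its values at the mixtures of `σ` with the maximally mixed
state: if these stay bounded, the kernel of `σ` does not contribute, so that the support condition
holds, and the divergence is at most the bound in the limit. -/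
theorem choiDivergence_le_of_forall_mixture_le {α : ℝ} (hα : 1 < α) (hΓ : Γ.PosSemidef)
    (hΓ1 : traceB Γ = 1) {ρ : Matrix A A ℂ} (hρ : ρ ∈ densityOperators A) {σ : Matrix B B ℂ}
    (hσ : σ.PosSemidef) {c : ℝ}
    (h : ∀ t ∈ Set.Ioo (0 : ℝ) 1, choiDivergence α Γ ρ (mixture t σ) ≤
      (c : EReal) + ((-Real.logb 2 (1 - t) : ℝ) : EReal)) :
    choiDivergence α Γ ρ σ ≤ c := by
  have hα0 : 0 < α := by linarith
  have hα1 : 0 < α - 1 := by linarith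
  have hp := one_div_mem_Ioo hα
  have hcard : (0 : ℝ) < Fintype.card B := by exact_mod_cast Fintype.card_pos
  obtain ⟨P, κ, hκ, hP, hPP, hσP, hS, -, hmix⟩ := exists_kernelProjection hp hσ
  have hsupp' : ∀ t ∈ Set.Ioo (0 : ℝ) 1, SupportLE (sandwichedState Γ ρ) (ρ ⊗ₖ mixture t σ) :=
    fun t ht => supportLE_of_posDef hΓ hρ.1 (posDef_mixture ht hσ)
  have hpos : ∀ t ∈ Set.Ioo (0 : ℝ) 1,
      0 < schattenNorm α (sandwichedChoi (1 / α) Γ ρ (mixture t σ)) := fun t ht =>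
    schattenNorm_sandwichedChoi_pos_of_mem hα hΓ hΓ1 hρ (posDef_mixture ht hσ).posSemidef
      (hsupp' t ht)
  have hreal : ∀ t ∈ Set.Ioo (0 : ℝ) 1, α / (α - 1) *
      Real.logb 2 (schattenNorm α (sandwichedChoi (1 / α) Γ ρ (mixture t σ))) ≤
        c - Real.logb 2 (1 - t) := fun t ht => by
    have := h t ht
    rwa [choiDivergence_eq hα hΓ hρ.1 (posDef_mixture ht hσ).posSemidef (hsupp' t ht),
      ← EReal.coe_add, EReal.coe_le_coe_iff, ← sub_eq_add_neg] at this
  set Z := CFC.rpow Γ (1 / 2) * (CFC.rpow ρ (1 / α) ⊗ₖ P) * CFC.rpow Γ (1 / 2) with hZdef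
  have hPpsd : P.PosSemidef := by
    have := posSemidef_conjTranspose_mul_self P
    rwa [hP, hPP] at this
  have hZpsd : Z.PosSemidef := posSemidef_conj_sqrt Γ ((posSemidef_rpow ρ _).kronecker hPpsd)
  -- the contribution of the kernel of `σ` is bounded by a multiple of `t^(1 - 1/α)`
  have hZle : ∀ t ∈ Set.Ioc (0 : ℝ) (1 / 2), schattenNorm α Z ≤
      (t / Fintype.card B) ^ (1 - 1 / α) * (2 : ℝ) ^ ((α - 1) / α * (c + 1)) := by
    intro t ht
    have ht' : t ∈ Set.Ioo (0 : ℝ) 1 := ⟨ht.1, by linarith [ht.2]⟩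
    have htd : 0 < t / Fintype.card B := div_pos ht.1 hcard
    have h1 := schattenNorm_mono hα
      (by rw [kronecker_smul, Matrix.mul_smul, smul_mul_assoc]
          exact hZpsd.smul (Real.rpow_nonneg htd.le _))
      (sandwichedChoi_mono (p := 1 / α) Γ ρ (hmix t ht').2.1)
    rw [kronecker_smul, Matrix.mul_smul, smul_mul_assoc,
      schattenNorm_smul hα hZpsd (Real.rpow_nonneg htd.le _)] at h1
    have h2 : schattenNorm α (sandwichedChoi (1 / α) Γ ρ (mixture t σ)) ≤
        (2 : ℝ) ^ ((α - 1) / α * (c + 1)) := by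
      rw [← Real.logb_le_iff_le_rpow one_lt_two (hpos t ht')]
      have h3 := hreal t ht'
      have h4 : -1 ≤ Real.logb 2 (1 - t) := by
        rw [Real.le_logb_iff_rpow_le one_lt_two (by linarith [ht.2]), Real.rpow_neg_one]
        linarith [ht.2]
      rw [div_mul_eq_mul_div, div_le_iff₀ hα1] at h3
      rw [div_mul_eq_mul_div, le_div_iff₀ hα0]
      nlinarith
    have h5 := h1.trans h2
    rw [show 1 - 1 / α = -(1 / α - 1) by ring, Real.rpow_neg htd.le]
    rw [← div_eq_inv_mul, le_div_iff₀ (Real.rpow_pos_of_pos htd _), mul_comm]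
    exact h5
  have hZ0 : Z = 0 := by
    have hlim : Filter.Tendsto (fun t : ℝ => (t / Fintype.card B) ^ (1 - 1 / α) *
        (2 : ℝ) ^ ((α - 1) / α * (c + 1))) (nhdsWithin 0 (Set.Ioi 0)) (nhds 0) := by
      have hcont : Continuous fun t : ℝ => (t / Fintype.card B) ^ (1 - 1 / α) *
          (2 : ℝ) ^ ((α - 1) / α * (c + 1)) :=
        ((continuous_id.div_const _).rpow_const fun _ => Or.inr (by linarith [hp.2])).mul
          continuous_const
      have := (hcont.tendsto 0).mono_left (nhdsWithin_le_nhds (s := Set.Ioi 0))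
      rwa [zero_div, Real.zero_rpow (by linarith [hp.2]), zero_mul] at this
    have hle : schattenNorm α Z ≤ 0 := by
      refine ge_of_tendsto hlim ?_
      filter_upwards [Ioc_mem_nhdsGT (by norm_num : (0 : ℝ) < 1 / 2)] with t ht
      exact hZle t ht
    refine eq_zero_of_re_trace_rpow_eq_zero hα hZpsd ?_
    rw [re_trace_rpow_eq_schattenNorm_rpow hα, le_antisymm hle (schattenNorm_nonneg _ _),
      Real.zero_rpow hα0.ne']
  have hsupp : SupportLE (sandwichedState Γ ρ) (ρ ⊗ₖ σ) :=
    (supportLE_iff hΓ hρ.1 hσP hS).2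
      ((sqrt_mul_kronecker_mul_sqrt_eq_zero_iff hρ.1 hp.1 hP hPP).1 hZ0)
  have hG := schattenNorm_sandwichedChoi_pos_of_mem hα hΓ hΓ1 hρ hσ hsupp
  rw [choiDivergence_eq hα hΓ hρ.1 hσ hsupp, EReal.coe_le_coe_iff]
  have hle : ∀ t ∈ Set.Ioo (0 : ℝ) 1,
      α / (α - 1) * Real.logb 2 (schattenNorm α (sandwichedChoi (1 / α) Γ ρ σ)) ≤
        c - Real.logb 2 (1 - t) + Real.logb 2 (1 + t * κ) := by
    intro t ht
    have hk : 0 < 1 + t * κ := by have := mul_nonneg ht.1.le hκ; linarith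
    have hk' := Real.rpow_pos_of_pos hk (1 / α - 1)
    have h1 := sandwichedChoi_mono (p := 1 / α) Γ ρ (hmix t ht).2.2
    rw [kronecker_smul, Matrix.mul_smul, smul_mul_assoc] at h1
    have h2 := schattenNorm_mono hα ((posSemidef_sandwichedChoi (1 / α) Γ ρ σ).smul hk'.le) h1
    rw [schattenNorm_smul hα (posSemidef_sandwichedChoi _ _ _ _) hk'.le] at h2
    have h3 := mul_le_mul_of_nonneg_left
      (Real.logb_le_logb_of_le one_lt_two (mul_pos hk' hG) h2) (div_pos hα0 hα1).le
    rw [mul_logb_rpow hα hk hG] at h3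
    have h4 := hreal t ht
    rw [sandwichedChoi] at h4
    linarith
  have hlim : Filter.Tendsto (fun t : ℝ => c - Real.logb 2 (1 - t) + Real.logb 2 (1 + t * κ))
      (nhdsWithin 0 (Set.Ioi 0)) (nhds c) := by
    have hcont : ContinuousAt
        (fun t : ℝ => c - Real.logb 2 (1 - t) + Real.logb 2 (1 + t * κ)) 0 := by
      refine (continuousAt_const.sub ?_).add ?_
      · exact (ContinuousAt.log (by fun_prop) (by norm_num)).div_const _
      · exact (ContinuousAt.log (by fun_prop) (by norm_num)).div_const _
    have := hcont.tendsto.mono_left (nhdsWithin_le_nhds (s := Set.Ioi 0))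
    simpa using this
  refine ge_of_tendsto hlim ?_
  filter_upwards [Ioo_mem_nhdsGT (zero_lt_one (α := ℝ))] with t ht
  exact hle t ht

theorem exists_neg_logb_one_sub_lt {ε : ℝ} (hε : 0 < ε) :
    ∃ t : Set.Ioo (0 : ℝ) 1, -Real.logb 2 (1 - t.1) < ε := by
  have hcont : ContinuousAt (fun t : ℝ => -Real.logb 2 (1 - t)) 0 :=
    ((ContinuousAt.log (by fun_prop) (by norm_num)).div_const _).neg
  have h0 : ∀ᶠ t in nhds (0 : ℝ), -Real.logb 2 (1 - t) < ε :=
    hcont.eventually_lt continuousAt_const (by simpa using hε)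
  obtain ⟨t, h1, h2⟩ := ((h0.filter_mono nhdsWithin_le_nhds).and
    (Ioo_mem_nhdsGT (zero_lt_one (α := ℝ)))).exists
  exact ⟨⟨t, h2⟩, h1⟩

end Divergence

end QuantumChannel

theorem mainTheorem4 {A B : Type*} [Fintype A] [DecidableEq A] [Nonempty A]
    [Fintype B] [DecidableEq B] (α : ℝ) (hα : 1 < α)
    (N : Matrix A A ℂ →ₗ[ℂ] Matrix B B ℂ) (hN : IsQuantumChannel N) :
    -- the maximum and the minimum in the definition of the mutual information are attained
    (∀ ρ : densityOperators A,
      IsLeast (Set.range fun σ : densityOperators B =>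
          sandwichedRenyi α (channelState N ρ.1) (traceB (channelState N ρ.1) ⊗ₖ σ.1))
        (stateMutualInfo α (channelState N ρ.1))) ∧
    IsGreatest (Set.range fun ρ : densityOperators A => stateMutualInfo α (channelState N ρ.1))
      (channelMutualInfo α N) ∧
    -- it is the max-min of the divergence relative to `ρ_A ⊗ σ_B`
    channelMutualInfo α N =
      ⨆ ρ : densityOperators A, ⨅ σ : densityOperators B,
        sandwichedRenyi α (channelState N ρ.1) (ρ.1 ⊗ₖ σ.1) ∧
    -- the maximum and the minimum can be exchanged
    channelMutualInfo α N =
      ⨅ σ : densityOperators B, ⨆ ρ : densityOperators A,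
        sandwichedRenyi α (channelState N ρ.1) (ρ.1 ⊗ₖ σ.1) ∧
    -- the maximum and the minimum on the right-hand side are attained
    (∀ σ : densityOperators B,
      IsGreatest (Set.range fun ρ : densityOperators A =>
          sandwichedRenyi α (channelState N ρ.1) (ρ.1 ⊗ₖ σ.1))
        (⨆ ρ : densityOperators A, sandwichedRenyi α (channelState N ρ.1) (ρ.1 ⊗ₖ σ.1))) ∧
    IsLeast (Set.range fun σ : densityOperators B =>
        ⨆ ρ : densityOperators A, sandwichedRenyi α (channelState N ρ.1) (ρ.1 ⊗ₖ σ.1))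
      (channelMutualInfo α N) := by
  have hB : Nonempty B := nonempty_of_isTracePreserving hN.2
  have hΓ := posSemidef_choi hN.1
  have hΓ1 := traceB_choi hN.2
  have htr : ∀ ρ : densityOperators A, traceB (channelState N ρ.1) = ρ.1 := fun ρ =>
    traceB_sandwichedState hΓ1 ρ.2.1
  obtain ⟨h1, h2, h3, h4, h5⟩ := minimax_of_approximation
    (fun (ρ : densityOperators A) (σ : densityOperators B) => choiDivergence α (choi N) ρ.1 σ.1)
    {σ | σ.1.PosDef} (fun (t : Set.Ioo (0 : ℝ) 1) σ => ⟨mixture t.1 σ.1, mixture_mem t.2 σ.2⟩)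
    (fun t => -Real.logb 2 (1 - t.1)) (fun t σ => posDef_mixture t.2 σ.2.1)
    (fun ε hε => exists_neg_logb_one_sub_lt hε)
    (fun σ hσ => continuous_choiDivergence_left hα hΓ hΓ1 σ.2.1
      fun ρ hρ => supportLE_of_posDef hΓ hρ.1 hσ)
    (fun ρ t => continuous_choiDivergence_mixture hα hΓ hΓ1 ρ.2 t.2)
    (fun ρ σ t => choiDivergence_mixture_le hα hΓ hΓ1 ρ.2 σ.2.1 t.2)
    (fun ρ σ c h => choiDivergence_le_of_forall_mixture_le hα hΓ hΓ1 ρ.2 σ.2.1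
      fun t ht => h ⟨t, ht⟩)
    (fun c h => by
      obtain ⟨ρ, hρ, hle⟩ := exists_forall_le_schattenNorm hα (choi N)
        ((2 : ℝ) ^ ((α - 1) / α * c)) fun σ hσ hpd => by
          obtain ⟨ρ, hρ⟩ := h ⟨σ, hσ⟩ hpd
          exact ⟨ρ.1, ρ.2, (coe_le_choiDivergence_iff hα hΓ hΓ1 ρ.2 hpd c).1 hρ⟩
      exact ⟨⟨ρ, hρ⟩, fun σ hpd =>
        (coe_le_choiDivergence_iff hα hΓ hΓ1 hρ hpd c).2 (hle σ.1 σ.2 hpd)⟩)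
    (fun σ h => continuous_choiDivergence_left hα hΓ hΓ1 σ.2.1
      fun ρ hρ => supportLE_of_choiDivergence_ne_top (h ⟨ρ, hρ⟩))
  have hstate : ∀ ρ : densityOperators A, stateMutualInfo α (channelState N ρ.1) =
      ⨅ σ : densityOperators B, choiDivergence α (choi N) ρ.1 σ.1 := fun ρ => by
    rw [stateMutualInfo, htr]
    rfl
  have hchan : channelMutualInfo α N = ⨆ ρ : densityOperators A, ⨅ σ : densityOperators B,
      choiDivergence α (choi N) ρ.1 σ.1 := iSup_congr hstate
  refine ⟨fun ρ => ?_, ?_, hchan, hchan.trans h3, h4, ?_⟩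
  · rw [hstate, htr]
    exact h1 ρ
  · simp only [hstate, hchan]
    exact h2
  · rw [hchan, h3]
    exact h5
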